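/- Let $\mathbb T=\mathbb R/2\pi\mathbb Z$, let $Hf(\theta)=\frac1{2\pi}\,\mathrm{p.v.}\!\int_{-\pi}^{\pi}\cot\!\big(\tfrac{\theta-\vartheta}{2}\big)f(\vartheta)\,d\vartheta$ be the Hilbert transform on $\mathbb T$, let $v(f)$ be determined by $\partial_\theta v(f)=Hf$, $v(f)(0)=0$, and let $\{f,g\}=f\,\partial_\theta g-g\,\partial_\theta f$. Put $$L^{+}f=\{\tfrac12 f+v(f),\,\sin 2\theta\},\qquad L^{-}f=\{\tfrac12 f-v(f),\,\sin 2\theta\}.$$ Let $\rho_2(\theta)=\frac{1}{4\pi\sin^2\theta}$, with the square root $\rho_2^{1/2}(\theta)=\frac{1}{2\sqrt\pi\,\sin\theta}$, and $$\langle\xi,\eta\rangle_{\mathcal H_2}=\int_{-\pi}^{\pi}\rho_2\,\partial_\theta\xi\,\partial_\theta\eta\,d\theta,\qquad \|\eta\|_{\mathcal H_2}=\langle\eta,\eta\rangle_{\mathcal H_2}^{1/2}.$$ There exists an absolute constant $\lambda_1$ with $\frac1{50}<\lambda_1<\frac35$ such that the following holds. Let $m>3$ be an integer and let $\eta_0^{\pm}$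 be odd $C^1$ functions on $\mathbb T$ such that $\rho_2^{1/2}\partial_\theta\eta_0^{\pm}\in H^m(\mathbb T)$, $\|\eta_0^+\|_{\mathcal H_2}\neq0$ and $\langle L^+\eta_0^+,\eta_0^+\rangle_{\mathcal H_2}\ge0$. Let $(\eta^+,\eta^-)$ be the classical odd solution of $$\partial_t\eta^+=L^+\eta^+,\qquad \partial_t\eta^-=L^-\eta^-\qquad(t>0,\ \theta\in\mathbb T),\qquad \eta^{\pm}(0,\cdot)=\eta_0^{\pm},$$ with $\rho_2^{1/2}\partial_\theta\eta^{\pm}\in C([0,T];H^m(\mathbb T))\cap C^2([0,T];H^{m-2}(\mathbb T))$ for every $T>0$. Then $$\|\eta^+(t)\|_{\mathcal H_2}+\|\eta^-(t)\|_{\mathcal H_2}>E_1(t)^{1/2}>0\qquad\text{for all }t>0,$$ where $$E_1(t)=\frac{\langle\eta_0^+,\eta_0^+\rangle_{\mathcal H_2}+\frac1{\sqrt{\lambda_1}}\langle L^+\eta_0^+,\eta_0^+\rangle_{\mathcal H_2}}{2}\,e^{2\sqrt{\lambda_1}\,t}+\frac{\langle\eta_0^+,\eta_0^+\rangle_{\mathcal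 H_2}-\frac1{\sqrt{\lambda_1}}\langle L^+\eta_0^+,\eta_0^+\rangle_{\mathcal H_2}}{2}\,e^{-2\sqrt{\lambda_1}\,t}.$$ -/

import Mathlib

open Real Set Filter Topology MeasureTheory
open scoped ContDiff ENNReal

noncomputable section

namespace MHD

/-! ### Sobolev spaces on the torus -/

/-- Lebesgue measure on the torus `𝕋 = ℝ / 2πℤ`, represented by the interval `(-π, π]`. -/
abbrev torusMeasure : Measure ℝ := volume.restrict (Ioc (-π) π)

/-- The real Hilbert space `L²(𝕋)`. -/
abbrev L2 : Type := Lp ℝ 2 torusMeasure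

/-- `g` is the weak derivative of `f` on the torus: integration by parts holds against every
smooth `2π`-periodic test function. -/
def IsWeakDeriv (f g : L2) : Prop :=
  ∀ φ : ℝ → ℝ, ContDiff ℝ ∞ φ → Function.Periodic φ (2 * π) →
    ∫ θ, f θ * deriv φ θ ∂torusMeasure = -∫ θ, g θ * φ θ ∂torusMeasure

theorem integrable_mul_of_continuous (f : L2) {φ : ℝ → ℝ} (hφ : Continuous φ) :
    Integrable (fun θ => f θ * φ θ) torusMeasure := by
  obtain ⟨C, hC⟩ := (isCompact_Icc (a := -π) (b := π)).exists_bound_of_continuousOn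
    hφ.continuousOn
  have hf : Integrable f torusMeasure :=
    (Lp.memLp f).integrable (by norm_num)
  refine hf.mul_bdd (c := C) hφ.aestronglyMeasurable ?_
  refine (ae_restrict_mem measurableSet_Ioc).mono fun θ hθ => hC θ ⟨hθ.1.le, hθ.2⟩

theorem IsWeakDeriv.add {f g f' g' : L2} (h : IsWeakDeriv f g) (h' : IsWeakDeriv f' g') :
    IsWeakDeriv (f + f') (g + g') := by
  intro φ hφ hp
  have hd : Continuous (deriv φ) := hφ.continuous_deriv (by simp)
  have e1 : ∫ θ, (f + f' : L2) θ * deriv φ θ ∂torusMeasure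
      = ∫ θ, f θ * deriv φ θ ∂torusMeasure + ∫ θ, f' θ * deriv φ θ ∂torusMeasure := by
    rw [← integral_add (integrable_mul_of_continuous f hd) (integrable_mul_of_continuous f' hd)]
    refine integral_congr_ae ((Lp.coeFn_add f f').mono fun θ hθ => ?_)
    simp only [hθ, Pi.add_apply, add_mul]
  have e2 : ∫ θ, (g + g' : L2) θ * φ θ ∂torusMeasure
      = ∫ θ, g θ * φ θ ∂torusMeasure + ∫ θ, g' θ * φ θ ∂torusMeasure := by
    rw [← integral_add (integrable_mul_of_continuous g hφ.continuous)
      (integrable_mul_of_continuous g' hφ.continuous)]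
    refine integral_congr_ae ((Lp.coeFn_add g g').mono fun θ hθ => ?_)
    simp only [hθ, Pi.add_apply, add_mul]
  rw [e1, e2, h φ hφ hp, h' φ hφ hp]
  ring

theorem IsWeakDeriv.smul {f g : L2} (c : ℝ) (h : IsWeakDeriv f g) :
    IsWeakDeriv (c • f) (c • g) := by
  intro φ hφ hp
  have e : ∀ (u : L2) (ψ : ℝ → ℝ), ∫ θ, (c • u : L2) θ * ψ θ ∂torusMeasure
      = c * ∫ θ, u θ * ψ θ ∂torusMeasure := by
    intro u ψ
    rw [← integral_const_mul]
    refine integral_congr_ae ((Lp.coeFn_smul c u).mono fun θ hθ => ?_)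
    simp only [hθ, Pi.smul_apply, smul_eq_mul, mul_assoc]
  rw [e, e, h φ hφ hp]
  ring

theorem IsWeakDeriv.zero : IsWeakDeriv 0 0 := by
  have h : ∀ ψ : ℝ → ℝ, ∫ θ, (0 : L2) θ * ψ θ ∂torusMeasure = 0 := by
    intro ψ
    refine (integral_congr_ae ((Lp.coeFn_zero ℝ 2 torusMeasure).mono
      fun θ hθ => ?_)).trans (integral_zero ℝ ℝ)
    simp only [hθ, Pi.zero_apply, zero_mul]
  intro φ _ _
  rw [h, h, neg_zero]

/-- The Sobolev space `H^m(𝕋)`: an element is a tuple `(f, f', …, f^{(m)})` of functions in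
`L²(𝕋)`, each entry being the weak derivative of the preceding one (so that the tuple is determined
by `f`), with the norm `(∑ ‖f^{(k)}‖²)^{1/2}` inherited from the `ℓ²`-product. -/
def Sobolev (m : ℕ) : Submodule ℝ (PiLp 2 fun _ : Fin (m + 1) => L2) where
  carrier := {F | ∀ k : Fin m, IsWeakDeriv (F k.castSucc) (F k.succ)}
  add_mem' := fun hF hG k => (hF k).add (hG k)
  zero_mem' := fun _ => IsWeakDeriv.zero
  smul_mem' := fun c _ hF k => (hF k).smul c

/-- The element `F` of `H^m(𝕋)` is (the class of) the function `f`. -/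
def Represents {m : ℕ} (F : Sobolev m) (f : ℝ → ℝ) : Prop :=
  (F.1 0 : ℝ → ℝ) =ᵐ[torusMeasure] f

/-- The function `f` belongs to `H^m(𝕋)`. -/
def MemSobolev (m : ℕ) (f : ℝ → ℝ) : Prop :=
  ∃ F : Sobolev m, Represents F f

/-! ### The weighted space `𝓗₂` -/

/-- The weight `ρ₂ = 1 / (4π sin² θ)`. -/
def rho (θ : ℝ) : ℝ := 1 / (4 * π * sin θ ^ 2)

/-- The inner product `⟨ξ, η⟩ = ∫ ρ₂ ∂ξ ∂η` of `𝓗₂`. -/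
def inner2 (ξ η : ℝ → ℝ) : ℝ :=
  ∫ θ in (-π)..π, rho θ * deriv ξ θ * deriv η θ

/-- The norm `(∫ ρ₂ |∂η|²)^{1/2}` of `𝓗₂`. -/
def norm2 (η : ℝ → ℝ) : ℝ :=
  √(∫ θ in (-π)..π, rho θ * |deriv η θ| ^ 2)

/-- The function `ρ₂^{1/2} ∂η`, where `ρ₂^{1/2} = 1 / (2 √π sin θ)` is the square root of `ρ₂`
that is smooth away from its poles. -/
def weightedDeriv (η : ℝ → ℝ) (θ : ℝ) : ℝ :=
  deriv η θ / (2 * √π * sin θ)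

/-! ### The linearized operators -/

/-- The Lie bracket `{f, g} = f g' - g f'`. -/
def bracket (f g : ℝ → ℝ) (θ : ℝ) : ℝ :=
  f θ * deriv g θ - g θ * deriv f θ

/-- The Hilbert transform on the torus,
`H f(θ) = (1 / 2π) p.v. ∫ cot((θ - ϑ) / 2) f(ϑ) dϑ`, for `2π`-periodic `f`; the integral over one
period is written over `(θ - π, θ + π)` so that the singularity sits in the middle. -/
def hilbert (f : ℝ → ℝ) (θ : ℝ) : ℝ :=
  limUnder (𝓝[>] (0 : ℝ)) fun ε =>
    1 / (2 * π) *
      ((∫ ϑ in (θ - π)..(θ - ε), Real.cot ((θ - ϑ) / 2) * f ϑ) +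
        ∫ ϑ in (θ + ε)..(θ + π), Real.cot ((θ - ϑ) / 2) * f ϑ)

/-- The velocity `v(f)`, determined by `∂v = H f` and `v(0) = 0`. -/
def velocity (f : ℝ → ℝ) (θ : ℝ) : ℝ :=
  ∫ ϑ in (0 : ℝ)..θ, hilbert f ϑ

/-- `L⁺ f = {f / 2 + v(f), sin 2θ}`. -/
def Lplus (f : ℝ → ℝ) : ℝ → ℝ :=
  bracket (fun θ => 1 / 2 * f θ + velocity f θ) (fun θ => sin (2 * θ))

/-- `L⁻ f = {f / 2 - v(f), sin 2θ}`. -/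
def Lminus (f : ℝ → ℝ) : ℝ → ℝ :=
  bracket (fun θ => 1 / 2 * f θ - velocity f θ) (fun θ => sin (2 * θ))

/-! ### Solutions of the linearized problem -/

/-- An odd `C¹` function on the torus. -/
structure IsOddC1 (f : ℝ → ℝ) : Prop where
  odd : Function.Odd f
  periodic : Function.Periodic f (2 * π)
  contDiff : ContDiff ℝ 1 f

/-- Admissible initial data: an odd function `η₀` on the torus with `ρ₂^{1/2} ∂η₀ ∈ H^m(𝕋)`. -/
structure IsInitialDatum (m : ℕ) (η₀ : ℝ → ℝ) : Prop extends IsOddC1 η₀ where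
  mem : MemSobolev m (weightedDeriv η₀)

/-- `ρ₂^{1/2} ∂η ∈ C([0, T]; H^m(𝕋)) ∩ C²([0, T]; H^{m-2}(𝕋))`. -/
def HasRegularity (m : ℕ) (T : ℝ) (η : ℝ → ℝ → ℝ) : Prop :=
  (∃ U : ℝ → Sobolev m, ContinuousOn U (Icc 0 T) ∧
    ∀ t ∈ Icc 0 T, Represents (U t) (weightedDeriv (η t))) ∧
  ∃ V : ℝ → Sobolev (m - 2), ContDiffOn ℝ 2 V (Icc 0 T) ∧
    ∀ t ∈ Icc 0 T, Represents (V t) (weightedDeriv (η t))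

/-- `(η⁺, η⁻)` is a classical odd solution on `[0, T]` of `∂ₜη⁺ = L⁺η⁺`, `∂ₜη⁻ = L⁻η⁻` with initial
data `(η₀⁺, η₀⁻)`, in the class `C([0, T]; H^m) ∩ C²([0, T]; H^{m-2})` for `ρ₂^{1/2} ∂η^±`. -/
structure IsSolutionOn (m : ℕ) (T : ℝ) (η₀p η₀m : ℝ → ℝ) (ηp ηm : ℝ → ℝ → ℝ) : Prop where
  initial_plus : ηp 0 = η₀p
  initial_minus : ηm 0 = η₀m
  oddC1_plus : ∀ t ∈ Icc 0 T, IsOddC1 (ηp t)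
  oddC1_minus : ∀ t ∈ Icc 0 T, IsOddC1 (ηm t)
  equation_plus : ∀ t ∈ Ioo 0 T, ∀ θ, HasDerivAt (fun s => ηp s θ) (Lplus (ηp t) θ) t
  equation_minus : ∀ t ∈ Ioo 0 T, ∀ θ, HasDerivAt (fun s => ηm s θ) (Lminus (ηm t) θ) t
  regularity_plus : HasRegularity m T ηp
  regularity_minus : HasRegularity m T ηm

/-- The function `E₁(t)` with parameter `lam = λ₁`, for the initial datum `η₀ = η₀⁺`. -/
def growth (lam : ℝ) (η₀ : ℝ → ℝ) (t : ℝ) : ℝ :=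
  (inner2 η₀ η₀ + 1 / √lam * inner2 (Lplus η₀) η₀) / 2 * exp (2 * √lam * t) +
    (inner2 η₀ η₀ - 1 / √lam * inner2 (Lplus η₀) η₀) / 2 * exp (-(2 * √lam * t))

end MHD

end

noncomputable section

namespace MHD

/-! ### The tridiagonal operator on sequences -/

/-! Put u = ρ₂^{1/2} ∂η⁺, an odd element of L²(𝕋) with ‖u‖ = ‖η⁺‖ in 𝓗₂, and y_n = ∫ u sin (n-1)θ.
In these coordinates L = L⁺ is tridiagonal, L = D + S. Here D is diagonal with entries d_p = a_p -
a_{p+2}, where a_p is `amp p` and d_p is `diagCoeff p`, and S is skew-symmetric with entries ±a_p of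
linear growth.

For E = ‖u‖² the skewness of S gives E''/2 = ⟨L²u, u⟩ + ⟨Lu, Lu⟩ = ⟨Lu, (L + Lᵀ)u⟩ = 2‖Du‖² + 2⟨Su,
Du⟩. The cross term involves only a_{p+2}(d_p - d_{p+2}), which is small because d_p approaches -1/2
quickly. Although D is indefinite (d_1 = 11/18, the other entries being negative), D² is bounded
below, and the outcome is E'' ≥ 4·(1/10)·E (`coercive_coeff`, `coercive_hasSum`). Comparison with
u'' = 4λu for λ < 1/10 (`hyperbolic_lt`) gives ‖η⁺(t)‖² > E₁(t); the norm of η⁻ enters only as a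
nonnegative number.

The analytic work is to justify the matrix. The Hilbert transform acts by sin kθ ↦ -cos kθ on sine
coefficients, which yields the rows in `IsOddC1.sinFun_eq_rowFun`. `energy_growth` transfers the
pointwise equation to the L² curve u(t) and its two time derivatives. -/

/-- The off-diagonal coefficients of the matrix of `L⁺`. -/
def amp (p : ℕ) : ℝ := ((p : ℝ) - 2) ^ 2 * (p + 2) / (4 * (p : ℝ) ^ 2)

/-- The diagonal coefficients of the matrix of `L⁺`. -/
def diagCoeff (p : ℕ) : ℝ := amp p - amp (p + 2)

/-- The off-diagonal coefficients of the quadratic form of `⟨(L⁺)²η, η⟩ + ⟨L⁺η, L⁺η⟩`. -/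
def formCoeff (p : ℕ) : ℝ := amp (p + 2) * (diagCoeff p - diagCoeff (p + 2))

theorem amp_nonneg (p : ℕ) : 0 ≤ amp p := by unfold amp; positivity

theorem amp_le (p : ℕ) : amp p ≤ p + 1 := by
  unfold amp
  rcases Nat.eq_zero_or_pos p with rfl | hp
  · norm_num
  have h1 : (1 : ℝ) ≤ p := by exact_mod_cast hp
  rw [div_le_iff₀ (by positivity)]
  nlinarith [mul_pos (by linarith : (0 : ℝ) < p) (by linarith : (0 : ℝ) < p),
    mul_nonneg (by linarith : (0 : ℝ) ≤ p) (sq_nonneg ((p : ℝ) - 1)), sq_nonneg ((p : ℝ) - 1)]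

theorem diagCoeff_le (p : ℕ) (hp : 3 ≤ p) : diagCoeff p ≤ -(23 / 50) := by
  obtain ⟨q, rfl⟩ := Nat.exists_eq_add_of_le' hp
  unfold diagCoeff amp
  push_cast
  rw [div_sub_div _ _ (by positivity) (by positivity), div_le_iff₀ (by positivity), ← sub_nonneg]
  -- With p = q + 3 and denominators cleared, the difference of the two sides is a polynomial in q
  -- with nonnegative coefficients. The bounds below use the same device.
  ring_nf
  positivity

/-- Since `diagCoeff p` = -1/2 + O(p⁻²), its successive differences are O(p⁻³), which beats the
linear growth of `amp`. -/
theorem abs_formCoeff_le (p : ℕ) (hp : 3 ≤ p) : |formCoeff p| ≤ 1 / 20 := by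
  obtain ⟨q, rfl⟩ := Nat.exists_eq_add_of_le' hp
  have h : formCoeff (q + 3) = ((((q : ℝ) + 3) ^ 2 * (q + 7)) / (4 * (q + 5) ^ 2)) *
      ((((q : ℝ) + 1) ^ 2 * (q + 5) * ((q + 5) ^ 2 * (q + 7) ^ 2)
        - 2 * ((q : ℝ) + 3) ^ 2 * (q + 7) * ((q + 3) ^ 2 * (q + 7) ^ 2)
        + ((q : ℝ) + 5) ^ 2 * (q + 9) * ((q + 3) ^ 2 * (q + 5) ^ 2)) /
        (4 * (q + 3) ^ 2 * (q + 5) ^ 2 * (q + 7) ^ 2)) := by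
    unfold formCoeff diagCoeff amp
    push_cast
    have e1 : (q : ℝ) + 3 + 2 = q + 5 := by ring
    have e2 : (q : ℝ) + 5 + 2 = q + 7 := by ring
    have e3 : (q : ℝ) + 3 - 2 = q + 1 := by ring
    have e4 : (q : ℝ) + 5 - 2 = q + 3 := by ring
    have e5 : (q : ℝ) + 7 - 2 = q + 5 := by ring
    have e6 : (q : ℝ) + 7 + 2 = q + 9 := by ring
    simp only [e1, e2, e3, e4, e5, e6]
    field_simp
    ring
  rw [h, div_mul_div_comm, abs_le]
  constructor
  · rw [le_div_iff₀ (by positivity), ← sub_nonneg]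
    ring_nf
    positivity
  · rw [div_le_iff₀ (by positivity), ← sub_nonneg]
    ring_nf
    positivity

/-- A weight absorbing the off-diagonal part of the quadratic form. -/
def absorb (p : ℕ) : ℝ := if p < 3 then 0 else 1 / 12

/-- The value 1/12 is dictated by p = 1, where the left side is 31/405. -/
theorem half_abs_formCoeff_le (p : ℕ) (hp : 1 ≤ p) : |formCoeff p| / 2 ≤ absorb (p + 2) := by
  have h : absorb (p + 2) = 1 / 12 := by simp [absorb]; omega
  rw [h]
  rcases lt_or_ge p 3 with h3 | h3
  · interval_cases p <;> norm_num [formCoeff, diagCoeff, amp, abs_le]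
  · linarith [abs_formCoeff_le p h3]

/-- Diagonal dominance. Row p pays half of its coupling to row p + 2 and, through `absorb p`, half
of the coupling to row p - 2. Little room is left at p = 2, where the square is 9/64, and for p ≥ 3,
where (23/50)² must exceed 1/10 + 1/12 + 1/40. -/
theorem coercive_coeff (p : ℕ) (hp : 1 ≤ p) :
    1 / 10 + absorb p + |formCoeff p| / 2 ≤ diagCoeff p ^ 2 := by
  rcases lt_or_ge p 3 with h3 | h3
  · interval_cases p <;> norm_num [absorb, formCoeff, diagCoeff, amp, abs_of_nonneg]
  · have := abs_formCoeff_le p h3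
    have h2 := diagCoeff_le p h3
    have : absorb p = 1 / 12 := by simp [absorb]; omega
    nlinarith

/-- The relation `y' = L⁺ y` between shifted coefficient sequences. -/
def IsTridiag (y z : ℕ → ℝ) : Prop :=
  ∀ p, z (p + 2) = amp (p + 2) * (y (p + 4) - y (p + 2)) + amp p * (y (p + 2) - y p)

theorem sum_range_shift_two (R : ℕ → ℝ) (N : ℕ) :
    ∑ p ∈ Finset.range N, (R (p + 2) - R p) = R (N + 1) + R N - (R 1 + R 0) := by
  induction N with
  | zero => simp
  | succ n ih => rw [Finset.sum_range_succ, ih]; ring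

/-- The p-th summand of ⟨L²y, y⟩ + ⟨Ly, Ly⟩ equals that of the quadratic form 2(D² + coupling) up to
a telescoping difference, because the off-diagonal part is skew. The `absorb` terms in the
telescoping quantity move half of each coupling to the next row. -/
theorem coercive_term {y z x : ℕ → ℝ} (hyz : IsTridiag y z) (hzx : IsTridiag z x)
    (hy2 : y 2 = 0) (hz2 : z 2 = 0) (p : ℕ) :
    1 / 5 * y (p + 2) ^ 2
      + ((fun q => amp q * (y (q + 2) * z q + y q * z (q + 2))
          + 2 * (diagCoeff q * amp q * (y q * y (q + 2)))
          - 2 * (absorb q * y (q + 2) ^ 2)) (p + 2)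
        - (fun q => amp q * (y (q + 2) * z q + y q * z (q + 2))
          + 2 * (diagCoeff q * amp q * (y q * y (q + 2)))
          - 2 * (absorb q * y (q + 2) ^ 2)) p)
      ≤ x (p + 2) * y (p + 2) + z (p + 2) * z (p + 2) := by
  simp only
  have e : p + 2 + 2 = p + 4 := rfl
  rw [e]
  have h1 := hyz p
  have h2 := hzx p
  have key : x (p + 2) * y (p + 2) + z (p + 2) * z (p + 2)
      = 2 * (diagCoeff p ^ 2 * y (p + 2) ^ 2 + formCoeff p * (y (p + 2) * y (p + 4)))
        + (amp (p + 2) * (y (p + 4) * z (p + 2) + y (p + 2) * z (p + 4))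
          + 2 * (diagCoeff (p + 2) * amp (p + 2) * (y (p + 2) * y (p + 4)))
        - (amp p * (y (p + 2) * z p + y p * z (p + 2))
          + 2 * (diagCoeff p * amp p * (y p * y (p + 2))))) := by
    have h3 : z (p + 2) * z (p + 2) = (amp (p + 2) * (y (p + 4) - y (p + 2))
      + amp p * (y (p + 2) - y p)) * z (p + 2) := by rw [← h1]
    have h4 : 2 * diagCoeff p * y (p + 2) * z (p + 2) = 2 * diagCoeff p * y (p + 2) *
      (amp (p + 2) * (y (p + 4) - y (p + 2)) + amp p * (y (p + 2) - y p)) := by rw [← h1]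
    have hd : diagCoeff p = amp p - amp (p + 2) := rfl
    have ho : formCoeff p = amp (p + 2) * (diagCoeff p - diagCoeff (p + 2)) := rfl
    rw [h3, h2, ho]
    rw [hd] at h4 ⊢
    linear_combination h4
  rw [key]
  -- Row 0 involves only `y 2 = z 2 = 0`, so nothing has to be absorbed there.
  rcases Nat.eq_zero_or_pos p with rfl | hp
  · simp only [zero_add, hy2, hz2]
    have : absorb 2 = 0 := by simp [absorb]
    rw [this]
    nlinarith
  have c1 := coercive_coeff p hp
  have c2 := half_abs_formCoeff_le p hp
  have c3 : -(|formCoeff p| / 2 * (y (p + 2) ^ 2 + y (p + 4) ^ 2))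
      ≤ formCoeff p * (y (p + 2) * y (p + 4)) := by
    have a1 : |y (p + 2) * y (p + 4)| ≤ (y (p + 2) ^ 2 + y (p + 4) ^ 2) / 2 := by
      rw [abs_le]
      constructor <;> nlinarith [sq_nonneg (y (p + 2) + y (p + 4)),
        sq_nonneg (y (p + 2) - y (p + 4))]
    have a2 := neg_abs_le (formCoeff p * (y (p + 2) * y (p + 4)))
    rw [abs_mul] at a2
    have a3 := mul_le_mul_of_nonneg_left a1 (abs_nonneg (formCoeff p))
    linarith
  have c4 := mul_le_mul_of_nonneg_right c1 (sq_nonneg (y (p + 2)))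
  have c5 := mul_le_mul_of_nonneg_right c2 (sq_nonneg (y (p + 4)))
  nlinarith

theorem abs_diagCoeff_le (p : ℕ) : |diagCoeff p| ≤ 1 := by
  rcases Nat.eq_zero_or_pos p with rfl | hp
  · norm_num [diagCoeff, amp]
  obtain ⟨q, rfl⟩ := Nat.exists_eq_add_of_le' hp
  unfold diagCoeff amp
  push_cast
  rw [div_sub_div _ _ (by positivity) (by positivity), abs_le]
  constructor
  · rw [le_div_iff₀ (by positivity), ← sub_nonneg]
    ring_nf
    positivity
  · rw [div_le_iff₀ (by positivity), ← sub_nonneg]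
    ring_nf
    positivity

/-- Summation leaves boundary terms `R N`, `R (N + 1)`. They contain `amp` times y times y or z, so
linear growth is offset by the O(1/n) decay of y, and the remaining factor tends to 0. No decay of x
is needed. -/
theorem coercive_hasSum {y z x : ℕ → ℝ} (hyz : IsTridiag y z) (hzx : IsTridiag z x)
    (hy1 : y 1 = 0) (hy2 : y 2 = 0) (hz1 : z 1 = 0) (hz2 : z 2 = 0)
    {C : ℝ} (hy : ∀ n : ℕ, (n + 1) * |y n| ≤ C) (hz : Tendsto z atTop (𝓝 0))
    {Q S : ℝ} (hQ : HasSum (fun p => y (p + 2) ^ 2) Q)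
    (hS : HasSum (fun p => x (p + 2) * y (p + 2) + z (p + 2) * z (p + 2)) S) :
    1 / 5 * Q ≤ S := by
  set R : ℕ → ℝ := fun q => amp q * (y (q + 2) * z q + y q * z (q + 2))
          + 2 * (diagCoeff q * amp q * (y q * y (q + 2)))
          - 2 * (absorb q * y (q + 2) ^ 2) with hR
  have hy0 : Tendsto y atTop (𝓝 0) := by
    refine squeeze_zero_norm (a := fun n : ℕ => C * (1 / ((n : ℝ) + 1))) (fun n => ?_) ?_
    · rw [mul_one_div, le_div_iff₀ (by positivity), mul_comm]
      exact hy n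
    · simpa using tendsto_one_div_add_atTop_nhds_zero_nat.const_mul C
  have sh : ∀ {u : ℕ → ℝ}, Tendsto u atTop (𝓝 0) →
      Tendsto (fun n => |u (n + 2)|) atTop (𝓝 0) := fun hu => by
    simpa using ((tendsto_add_atTop_iff_nat 2).2 hu).abs
  have hRlim : Tendsto R atTop (𝓝 0) := by
    refine squeeze_zero_norm (a := fun q => C * |z q| + C * |z (q + 2)| + 2 * (C * |y (q + 2)|)
      + 2 * (C * |y (q + 2)|)) (fun q => ?_) ?_
    · have a1 : amp q * |y q| ≤ C :=
        (mul_le_mul_of_nonneg_right (amp_le q) (abs_nonneg _)).trans (hy q)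
      have a2 : amp q * |y (q + 2)| ≤ C := by
        refine (mul_le_mul_of_nonneg_right (amp_le q) (abs_nonneg _)).trans
          (le_trans ?_ (hy (q + 2)))
        refine mul_le_mul_of_nonneg_right ?_ (abs_nonneg _)
        push_cast; linarith
      have a3 : absorb q * |y (q + 2)| ≤ C := by
        refine le_trans (mul_le_mul_of_nonneg_right ?_ (abs_nonneg _)) (hy (q + 2))
        have : absorb q ≤ 1 := by unfold absorb; split_ifs <;> norm_num
        have : (0 : ℝ) ≤ ((q + 2 : ℕ) : ℝ) := by positivity
        linarith
      have a0 : 0 ≤ absorb q := by unfold absorb; split_ifs <;> norm_num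
      have b1 := mul_le_mul_of_nonneg_right a2 (abs_nonneg (z q))
      have b2 := mul_le_mul_of_nonneg_right a1 (abs_nonneg (z (q + 2)))
      have b3 := mul_le_mul_of_nonneg_right a1 (abs_nonneg (y (q + 2)))
      have b4 := mul_le_mul_of_nonneg_right a3 (abs_nonneg (y (q + 2)))
      have b5 : |diagCoeff q * amp q * (y q * y (q + 2))| ≤ amp q * |y q| * |y (q + 2)| := by
        rw [abs_mul, abs_mul, abs_mul, abs_of_nonneg (amp_nonneg q)]
        have := mul_le_mul_of_nonneg_right (abs_diagCoeff_le q)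
          (mul_nonneg (amp_nonneg q) (mul_nonneg (abs_nonneg (y q)) (abs_nonneg (y (q + 2)))))
        linarith
      have b6 : |amp q * (y (q + 2) * z q + y q * z (q + 2))|
          ≤ amp q * |y (q + 2)| * |z q| + amp q * |y q| * |z (q + 2)| := by
        rw [mul_add]
        refine (abs_add_le _ _).trans (le_of_eq ?_)
        rw [abs_mul, abs_mul, abs_mul, abs_mul, abs_of_nonneg (amp_nonneg q)]
        ring
      have b7 : |absorb q * y (q + 2) ^ 2| = absorb q * |y (q + 2)| * |y (q + 2)| := by
        rw [abs_mul, abs_of_nonneg a0, abs_pow]; ring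
      rw [Real.norm_eq_abs, hR]
      refine (abs_sub _ _).trans ?_
      refine (add_le_add (abs_add_le _ _) le_rfl).trans ?_
      rw [abs_mul 2, abs_mul 2, abs_two, b7]
      linarith
    · have hz' : Tendsto (fun q => |z q|) atTop (𝓝 0) := by simpa using hz.abs
      simpa using ((((hz'.const_mul C).add ((sh hz).const_mul C)).add
        (((sh hy0).const_mul C).const_mul 2)).add (((sh hy0).const_mul C).const_mul 2))
  have hR0 : R 0 = 0 := by
    simp [hR, hy2, hz2, absorb]
  have hR1 : R 1 = 0 := by
    simp [hR, hy1, hz1, absorb]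
  have hle : ∀ N, 1 / 5 * (∑ p ∈ Finset.range N, y (p + 2) ^ 2) + (R (N + 1) + R N)
      ≤ ∑ p ∈ Finset.range N, (x (p + 2) * y (p + 2) + z (p + 2) * z (p + 2)) := by
    intro N
    have := sum_range_shift_two R N
    rw [hR0, hR1] at this
    rw [show R (N + 1) + R N = R (N + 1) + R N - (0 + 0) by ring, ← this, Finset.mul_sum,
      ← Finset.sum_add_distrib]
    exact Finset.sum_le_sum fun p _ => coercive_term hyz hzx hy2 hz2 p
  have l1 := (hQ.tendsto_sum_nat.const_mul (1 / 5)).add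
    (((tendsto_add_atTop_iff_nat 1).2 hRlim).add hRlim)
  rw [add_zero, add_zero] at l1
  exact le_of_tendsto_of_tendsto' l1 hS.tendsto_sum_nat hle

/-! ### A differential inequality -/

/-- The solution of `u'' = 4 lam u` with `u(0) = e₀`, `u'(0) = 2 e₁`. -/
def hyperbolic (lam e₀ e₁ t : ℝ) : ℝ :=
  (e₀ + 1 / √lam * e₁) / 2 * exp (2 * √lam * t) +
    (e₀ - 1 / √lam * e₁) / 2 * exp (-(2 * √lam * t))

/-- In the form e₀ cosh + (e₁/√lam) sinh, the first term is positive and the second nonnegative. -/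
theorem hyperbolic_pos {lam e₀ e₁ t : ℝ} (h0 : 0 < e₀) (h1 : 0 ≤ e₁) (ht : 0 ≤ t) :
    0 < hyperbolic lam e₀ e₁ t := by
  have hs := Real.sqrt_nonneg lam
  have a : exp (-(2 * √lam * t)) ≤ exp (2 * √lam * t) :=
    Real.exp_le_exp.2 (by have := mul_nonneg hs ht; linarith)
  have b := exp_pos (-(2 * √lam * t))
  have c : 0 ≤ 1 / √lam * e₁ := by positivity
  unfold hyperbolic
  nlinarith [mul_nonneg c (sub_nonneg.2 a)]

/-- Second-order comparison: `E'' ≥ 4 μ E` with `μ > lam` forces `E` above the solution of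
`u'' = 4 lam u` with the same data. -/
theorem hyperbolic_lt {lam mu T : ℝ} (hlam : 0 < lam) (hmu : lam < mu) (hT : 0 < T)
    {E E1 E2 : ℝ → ℝ} (hE : ContinuousOn E (Icc 0 T)) (hE1 : ContinuousOn E1 (Icc 0 T))
    (d1 : ∀ t ∈ Ioo 0 T, HasDerivAt E (E1 t) t) (d2 : ∀ t ∈ Ioo 0 T, HasDerivAt E1 (E2 t) t)
    (hnn : ∀ t ∈ Icc 0 T, 0 ≤ E t)
    (hineq : ∀ t ∈ Ioo 0 T, 4 * mu * E t ≤ E2 t) (h0 : 0 < E 0) (h1 : 0 ≤ E1 0)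
    {e₁ : ℝ} (he : E1 0 = 2 * e₁) :
    hyperbolic lam (E 0) e₁ T < E T := by
  have hint : interior (Icc 0 T) = Ioo 0 T := interior_Icc
  -- E'' ≥ 0 and E'(0) ≥ 0 make E nondecreasing, hence positive. This turns `lam < mu` into the
  -- strict inequality E'' > 4 lam E.
  have m1 : MonotoneOn E1 (Icc 0 T) := by
    refine monotoneOn_of_deriv_nonneg (convex_Icc 0 T) hE1 ?_ ?_
    · rw [hint]; exact fun t ht => (d2 t ht).differentiableAt.differentiableWithinAt
    · rw [hint]; intro t ht
      rw [(d2 t ht).deriv]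
      exact le_trans (mul_nonneg (by linarith) (hnn t (Ioo_subset_Icc_self ht))) (hineq t ht)
  have m0 : MonotoneOn E (Icc 0 T) := by
    refine monotoneOn_of_deriv_nonneg (convex_Icc 0 T) hE ?_ ?_
    · rw [hint]; exact fun t ht => (d1 t ht).differentiableAt.differentiableWithinAt
    · rw [hint]; intro t ht
      rw [(d1 t ht).deriv]
      exact h1.trans (m1 ⟨le_rfl, hT.le⟩ (Ioo_subset_Icc_self ht) ht.1.le)
  have hpos : ∀ t ∈ Ioo 0 T, 0 < E t := fun t ht =>
    h0.trans_le (m0 ⟨le_rfl, hT.le⟩ (Ioo_subset_Icc_self ht) ht.1.le)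
  set k := 2 * √lam with hk
  have hsq : √lam * √lam = lam := Real.mul_self_sqrt hlam.le
  have hspos : 0 < √lam := Real.sqrt_pos.2 hlam
  set A := (E 0 + 1 / √lam * e₁) / 2
  set B := (E 0 - 1 / √lam * e₁) / 2
  have hAB : A + B = E 0 := by simp only [A, B]; ring
  have hAB' : k * (A - B) = E1 0 := by simp only [A, B, hk, he]; field_simp; ring
  have dexp : ∀ t, HasDerivAt (fun t => exp (k * t)) (exp (k * t) * k) t := fun t => by
    simpa using ((hasDerivAt_id t).const_mul k).exp
  have dexp' : ∀ t, HasDerivAt (fun t => exp (-(k * t))) (exp (-(k * t)) * (-k)) t := fun t => by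
    simpa using (((hasDerivAt_id t).const_mul k).neg).exp
  set z : ℝ → ℝ := fun t => E t - (A * exp (k * t) + B * exp (-(k * t))) with hz
  set z1 : ℝ → ℝ := fun t => E1 t - (A * (exp (k * t) * k) + B * (exp (-(k * t)) * (-k))) with hz1
  have dz : ∀ t ∈ Ioo 0 T, HasDerivAt z (z1 t) t := fun t ht =>
    (d1 t ht).sub (((dexp t).const_mul A).add ((dexp' t).const_mul B))
  have dz1 : ∀ t ∈ Ioo 0 T, HasDerivAt z1
      (E2 t - (A * (exp (k * t) * k * k) + B * (exp (-(k * t)) * (-k) * (-k)))) t := fun t ht =>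
    (d2 t ht).sub ((((dexp t).mul_const k).const_mul A).add (((dexp' t).mul_const (-k)).const_mul B))
  have cz : ContinuousOn z (Icc 0 T) := hE.sub (by fun_prop)
  have cz1 : ContinuousOn z1 (Icc 0 T) := hE1.sub (by fun_prop)
  -- With k² = 4 lam, the operator ∂² - k² factors as (∂ + k)(∂ - k). Each factor is integrated with
  -- its exponential, starting from zero data for z.
  have s1 : StrictMonoOn (fun t => exp (k * t) * (z1 t - k * z t)) (Icc 0 T) := by
    refine strictMonoOn_of_deriv_pos (convex_Icc 0 T) ?_ ?_
    · exact (by fun_prop : ContinuousOn (fun t => exp (k * t)) (Icc 0 T)).mul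
        (cz1.sub (cz.const_smul k))
    · rw [hint]; intro t ht
      rw [HasDerivAt.deriv ((dexp t).fun_mul ((dz1 t ht).fun_sub ((dz t ht).const_mul k)))]
      have h3 := hineq t ht
      have h4 := hpos t ht
      have h5 : 0 < E2 t - k * k * E t := by
        have : k * k = 4 * lam := by rw [hk]; linear_combination 4 * hsq
        rw [this]; nlinarith
      have h6 := mul_pos (exp_pos (k * t)) h5
      simp only [hz, hz1]
      nlinarith
  have z0 : z 0 = 0 := by simp only [hz]; simp; linarith
  have z10 : z1 0 = 0 := by simp only [hz1]; simp; linarith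
  have p1 : ∀ t ∈ Ioo 0 T, 0 < z1 t - k * z t := fun t ht => by
    have := s1 ⟨le_rfl, hT.le⟩ (Ioo_subset_Icc_self ht) ht.1
    simp only [z0, z10, mul_zero, sub_zero] at this
    exact pos_of_mul_pos_right this (exp_pos _).le
  have s2 : StrictMonoOn (fun t => exp (-(k * t)) * z t) (Icc 0 T) := by
    refine strictMonoOn_of_deriv_pos (convex_Icc 0 T) ?_ ?_
    · exact (by fun_prop : ContinuousOn (fun t => exp (-(k * t))) (Icc 0 T)).mul cz
    · rw [hint]; intro t ht
      rw [HasDerivAt.deriv ((dexp' t).fun_mul (dz t ht))]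
      have := mul_pos (exp_pos (-(k * t))) (p1 t ht)
      nlinarith
  have := s2 ⟨le_rfl, hT.le⟩ ⟨hT.le, le_rfl⟩ hT
  simp only [z0, mul_zero] at this
  have := pos_of_mul_pos_right this (exp_pos _).le
  simp only [hz] at this
  have e : hyperbolic lam (E 0) e₁ T = A * exp (k * T) + B * exp (-(k * T)) := rfl
  rw [e]
  linarith

/-! ### The Hilbert transform of an odd `C¹` function -/

theorem IsOddC1.continuous {f : ℝ → ℝ} (hf : IsOddC1 f) : Continuous f := hf.contDiff.continuous

theorem IsOddC1.hasDerivAt {f : ℝ → ℝ} (hf : IsOddC1 f) (θ : ℝ) : HasDerivAt f (deriv f θ) θ :=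
  (hf.contDiff.differentiable one_ne_zero θ).hasDerivAt

theorem IsOddC1.continuous_deriv {f : ℝ → ℝ} (hf : IsOddC1 f) : Continuous (deriv f) :=
  hf.contDiff.continuous_deriv le_rfl

theorem IsOddC1.deriv_even {f : ℝ → ℝ} (hf : IsOddC1 f) (θ : ℝ) : deriv f (-θ) = deriv f θ := by
  have h : deriv (fun x => f (-x)) θ = -deriv f (-θ) := deriv_comp_neg f θ
  rw [show (fun x => f (-x)) = fun x => -f x from funext hf.odd, deriv.fun_neg] at h
  linarith

theorem IsOddC1.deriv_periodic {f : ℝ → ℝ} (hf : IsOddC1 f) :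
    Function.Periodic (deriv f) (2 * π) := by
  intro x
  rw [← deriv_comp_add_const]
  congr 1
  exact funext hf.periodic

theorem IsOddC1.exists_lipschitz {f : ℝ → ℝ} (hf : IsOddC1 f) :
    ∃ M : ℝ, 0 ≤ M ∧ ∀ x y, |f x - f y| ≤ M * |x - y| := by
  obtain ⟨M, hM⟩ := hf.deriv_periodic.isBounded_of_continuous (by positivity)
    hf.continuous_deriv |>.exists_norm_le
  refine ⟨M, (norm_nonneg _).trans (hM _ ⟨0, rfl⟩), fun x y => ?_⟩
  exact Convex.norm_image_sub_le_of_norm_deriv_le (s := univ)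
    (fun z _ => (hf.hasDerivAt z).differentiableAt) (fun z _ => hM _ ⟨z, rfl⟩) convex_univ
    (mem_univ y) (mem_univ x)

/-- The symmetrized integrand of the Hilbert transform. -/
def hilbertKernel (f : ℝ → ℝ) (θ s : ℝ) : ℝ := Real.cot (s / 2) * (f (θ - s) - f (θ + s))

theorem measurable_cot : Measurable Real.cot := by
  have : Real.cot = fun x => cos x / sin x := funext Real.cot_eq_cos_div_sin
  rw [this]
  exact Real.measurable_cos.div Real.measurable_sin

theorem measurable_hilbertKernel {f : ℝ → ℝ} (hf : Continuous f) :
    Measurable fun p : ℝ × ℝ => hilbertKernel f p.1 p.2 := by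
  unfold hilbertKernel
  exact (measurable_cot.comp (by fun_prop)).mul (by fun_prop)

/-- Jordan's inequality gives sin (s/2) ≥ s/π. Hence the Lipschitz bound on f cancels the
singularity of the symmetrized kernel. -/
theorem abs_cot_half_mul_le {s : ℝ} (hs : s ∈ Ioc 0 π) : |Real.cot (s / 2)| * s ≤ π := by
  have h1 : 2 / π * (s / 2) ≤ sin (s / 2) :=
    Real.mul_le_sin (by linarith [hs.1]) (by linarith [hs.2])
  have h2 : 2 / π * (s / 2) = s / π := by ring
  rw [h2] at h1
  have h3 : 0 < s / π := div_pos hs.1 pi_pos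
  have h4 : 0 < sin (s / 2) := h3.trans_le h1
  rw [Real.cot_eq_cos_div_sin, abs_div, abs_of_pos h4, div_mul_eq_mul_div, div_le_iff₀ h4]
  rw [div_le_iff₀ pi_pos] at h1
  nlinarith [abs_cos_le_one (s / 2), hs.1, abs_nonneg (cos (s / 2))]

theorem IsOddC1.exists_kernel_bound {f : ℝ → ℝ} (hf : IsOddC1 f) :
    ∃ C : ℝ, ∀ θ, ∀ s ∈ Ioc 0 π, |hilbertKernel f θ s| ≤ C := by
  obtain ⟨M, hM0, hM⟩ := hf.exists_lipschitz
  refine ⟨π * (M * 2), fun θ s hs => ?_⟩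
  have h1 := hM (θ - s) (θ + s)
  have h2 : |θ - s - (θ + s)| = s * 2 := by
    rw [show θ - s - (θ + s) = -(s * 2) by ring, abs_neg, abs_of_pos (by linarith [hs.1])]
  rw [h2] at h1
  rw [hilbertKernel, abs_mul]
  have h3 := mul_le_mul_of_nonneg_left h1 (abs_nonneg (Real.cot (s / 2)))
  have h4 := mul_le_mul_of_nonneg_right (abs_cot_half_mul_le hs) (by positivity : 0 ≤ M * 2)
  nlinarith

theorem IsOddC1.intervalIntegrable_kernel {f : ℝ → ℝ} (hf : IsOddC1 f) (θ : ℝ) :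
    IntervalIntegrable (hilbertKernel f θ) volume 0 π := by
  obtain ⟨C, hC⟩ := hf.exists_kernel_bound
  rw [intervalIntegrable_iff_integrableOn_Ioc_of_le pi_pos.le]
  refine Measure.integrableOn_of_bounded (M := C) (by simp) ?_ ?_
  · exact ((measurable_hilbertKernel hf.continuous).comp
      (measurable_const.prodMk measurable_id)).aestronglyMeasurable
  · exact (ae_restrict_mem measurableSet_Ioc).mono fun s hs => hC θ s hs

/-- The Hilbert transform as an absolutely convergent integral. -/
def hilbertInt (f : ℝ → ℝ) (θ : ℝ) : ℝ := 1 / (2 * π) * ∫ s in (0 : ℝ)..π, hilbertKernel f θ s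

theorem cot_half_intervalIntegrable {h : ℝ → ℝ} (hh : Continuous h) {ε : ℝ} (hε : 0 < ε)
    (hε' : ε ≤ π) : IntervalIntegrable (fun s => Real.cot (s / 2) * h s) volume ε π := by
  refine ContinuousOn.intervalIntegrable ?_
  rw [uIcc_of_le hε']
  have : (fun s => Real.cot (s / 2) * h s) = fun s => cos (s / 2) / sin (s / 2) * h s := by
    funext s; rw [Real.cot_eq_cos_div_sin]
  rw [this]
  refine ContinuousOn.mul (ContinuousOn.div (by fun_prop) (by fun_prop) fun s hs => ?_)
    hh.continuousOn
  exact (sin_pos_of_pos_of_lt_pi (by linarith [hs.1]) (by linarith [hs.2, pi_pos])).ne'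

theorem hilbert_truncated {f : ℝ → ℝ} (hf : Continuous f) (θ : ℝ) {ε : ℝ} (hε : 0 < ε)
    (hε' : ε ≤ π) :
    (∫ ϑ in (θ - π)..(θ - ε), Real.cot ((θ - ϑ) / 2) * f ϑ) +
        ∫ ϑ in (θ + ε)..(θ + π), Real.cot ((θ - ϑ) / 2) * f ϑ
      = ∫ s in ε..π, hilbertKernel f θ s := by
  have h1 : ∫ ϑ in (θ - π)..(θ - ε), Real.cot ((θ - ϑ) / 2) * f ϑ
      = ∫ s in ε..π, Real.cot (s / 2) * f (θ - s) := by
    rw [← intervalIntegral.integral_comp_sub_left (fun ϑ => Real.cot ((θ - ϑ) / 2) * f ϑ) θ]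
    simp only [sub_sub_cancel]
  have h2 : ∫ ϑ in (θ + ε)..(θ + π), Real.cot ((θ - ϑ) / 2) * f ϑ
      = ∫ s in ε..π, -(Real.cot (s / 2) * f (θ + s)) := by
    rw [← intervalIntegral.integral_comp_add_left (fun ϑ => Real.cot ((θ - ϑ) / 2) * f ϑ) θ]
    refine intervalIntegral.integral_congr fun s _ => ?_
    simp only [sub_add_cancel_left]
    rw [neg_div, Real.cot_eq_cos_div_sin, Real.cot_eq_cos_div_sin, cos_neg, sin_neg]
    ring
  rw [h1, h2, intervalIntegral.integral_neg, ← sub_eq_add_neg, ← intervalIntegral.integral_sub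
    (cot_half_intervalIntegrable (h := fun s => f (θ - s)) (by fun_prop) hε hε')
    (cot_half_intervalIntegrable (h := fun s => f (θ + s)) (by fun_prop) hε hε')]
  refine intervalIntegral.integral_congr fun s _ => ?_
  simp only [hilbertKernel]
  ring

theorem IsOddC1.hilbert_eq {f : ℝ → ℝ} (hf : IsOddC1 f) : hilbert f = hilbertInt f := by
  funext θ
  refine Tendsto.limUnder_eq ?_
  have h1 : Tendsto (fun ε => 1 / (2 * π) * ∫ s in ε..π, hilbertKernel f θ s) (𝓝[>] 0)
      (𝓝 (hilbertInt f θ)) := by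
    refine Tendsto.const_mul _ ?_
    have h := intervalIntegral.continuousOn_primitive_interval_left
      (a := 0) (b := π) (μ := volume) (f := hilbertKernel f θ) (by
        rw [uIcc_of_le pi_pos.le, integrableOn_Icc_iff_integrableOn_Ioc]
        exact (hf.intervalIntegrable_kernel θ).1)
    rw [uIcc_of_le pi_pos.le] at h
    refine (h 0 ⟨le_rfl, pi_pos.le⟩).tendsto.mono_left ?_
    rw [← nhdsWithin_Ioc_eq_nhdsGT pi_pos]
    exact nhdsWithin_mono _ Ioc_subset_Icc_self
  refine h1.congr' ?_
  filter_upwards [Ioc_mem_nhdsGT pi_pos] with ε hε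
  rw [hilbert_truncated hf.continuous θ hε.1 hε.2]

theorem IsOddC1.continuous_hilbertInt {f : ℝ → ℝ} (hf : IsOddC1 f) :
    Continuous (hilbertInt f) := by
  obtain ⟨C, hC⟩ := hf.exists_kernel_bound
  refine continuous_const.mul ?_
  refine intervalIntegral.continuous_of_dominated_interval (bound := fun _ => C) (fun θ => ?_)
    (fun θ => ?_) intervalIntegrable_const ?_
  · exact ((measurable_hilbertKernel hf.continuous).comp
      (measurable_const.prodMk measurable_id)).aestronglyMeasurable
  · rw [uIoc_of_le pi_pos.le]
    exact Eventually.of_forall fun s hs => hC θ s hs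
  · have := hf.continuous
    refine Eventually.of_forall fun s _ => ?_
    unfold hilbertKernel
    fun_prop

theorem IsOddC1.hilbertInt_even {f : ℝ → ℝ} (hf : IsOddC1 f) (θ : ℝ) :
    hilbertInt f (-θ) = hilbertInt f θ := by
  unfold hilbertInt
  congr 1
  refine intervalIntegral.integral_congr fun s _ => ?_
  simp only [hilbertKernel]
  rw [show -θ - s = -(θ + s) by ring, show -θ + s = -(θ - s) by ring, hf.odd, hf.odd]
  ring

/-! ### The Hilbert transform as a Fourier multiplier. -/

theorem cot_half_mul_sin_succ {s : ℝ} (hs : s ∈ Ioc 0 π) (k : ℕ) :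
    Real.cot (s / 2) * sin ((k + 1 : ℕ) * s)
      = Real.cot (s / 2) * sin (k * s) + (cos ((k + 1 : ℕ) * s) + cos (k * s)) := by
  have h4 : 0 < sin (s / 2) :=
    sin_pos_of_pos_of_lt_pi (by linarith [hs.1]) (by linarith [hs.2, pi_pos])
  rw [Real.cot_eq_cos_div_sin]
  have e1 : ((k + 1 : ℕ) : ℝ) * s = (k * s + s / 2) + s / 2 := by push_cast; ring
  have e2 : (k : ℝ) * s = (k * s + s / 2) - s / 2 := by ring
  generalize hb : (k : ℝ) * s + s / 2 = b at e1 e2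
  rw [e1, e2, sin_add, sin_sub, cos_add, cos_sub]
  generalize s / 2 = a at *
  field_simp
  ring

theorem integral_cos_nat (k : ℕ) (hk : k ≠ 0) : ∫ s in (0 : ℝ)..π, cos (k * s) = 0 := by
  rw [intervalIntegral.integral_comp_mul_left _ (by exact_mod_cast hk)]
  simp

/-- By the recursion in k, each step adds integrals of cosines of nonzero frequency; only the first
step, where cos 0 = 1 appears, contributes π. Integrability is carried along because additivity of
the integral requires it. -/
theorem integral_cot_half_mul_sin (k : ℕ) :
    IntervalIntegrable (fun s => Real.cot (s / 2) * sin ((k + 1 : ℕ) * s)) volume 0 π ∧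
    ∫ s in (0 : ℝ)..π, Real.cot (s / 2) * sin ((k + 1 : ℕ) * s) = π := by
  have step : ∀ k : ℕ, ∀ s ∈ uIoc (0 : ℝ) π, Real.cot (s / 2) * sin (k * s)
      + (cos ((k + 1 : ℕ) * s) + cos (k * s)) = Real.cot (s / 2) * sin ((k + 1 : ℕ) * s) := by
    intro k s hs
    rw [uIoc_of_le pi_pos.le] at hs
    exact (cot_half_mul_sin_succ hs k).symm
  have ci : ∀ k : ℕ, IntervalIntegrable (fun s => cos (k * s)) volume 0 π := fun k =>
    (by fun_prop : Continuous fun s : ℝ => cos (k * s)).intervalIntegrable _ _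
  induction k with
  | zero =>
    have h0 : (fun s => Real.cot (s / 2) * sin ((0 : ℕ) * s)
      + (cos ((0 + 1 : ℕ) * s) + cos ((0 : ℕ) * s))) = fun s => cos ((0 + 1 : ℕ) * s) + 1 := by
      funext s; simp
    constructor
    · refine IntervalIntegrable.congr (step 0) ?_
      rw [h0]
      exact (ci (0 + 1)).add intervalIntegrable_const
    · rw [← intervalIntegral.integral_congr_ae (Eventually.of_forall (step 0)), h0,
        intervalIntegral.integral_add (ci (0 + 1)) intervalIntegrable_const,
        integral_cos_nat _ (by norm_num)]
      simp
  | succ k ih =>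
    constructor
    · exact IntervalIntegrable.congr (step (k + 1)) (ih.1.add ((ci (k + 1 + 1)).add (ci (k + 1))))
    · rw [← intervalIntegral.integral_congr_ae (Eventually.of_forall (step (k + 1))),
        intervalIntegral.integral_add ih.1 ((ci (k + 1 + 1)).add (ci (k + 1))),
        intervalIntegral.integral_add (ci (k + 1 + 1)) (ci (k + 1)),
        integral_cos_nat _ (by norm_num), integral_cos_nat _ (by norm_num), ih.2]
      simp

theorem periodic_cos_nat (k : ℕ) : Function.Periodic (fun x => cos (k * x)) (2 * π) := fun x => by
  simp only
  rw [mul_add, cos_add_nat_mul_two_pi]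

theorem integral_shift {h : ℝ → ℝ} (hh : Function.Periodic h (2 * π)) (s : ℝ) :
    ∫ θ in (-π)..π, h (θ + s) = ∫ θ in (-π)..π, h θ := by
  rw [intervalIntegral.integral_comp_add_right]
  have := hh.intervalIntegral_add_eq (-π + s) (-π)
  rw [show -π + s + 2 * π = π + s by ring, show -π + 2 * π = π by ring] at this
  exact this

/-- The sine coefficient `∫ f sin kθ`. -/
def sineCoeff (f : ℝ → ℝ) (k : ℕ) : ℝ := ∫ θ in (-π)..π, f θ * sin (k * θ)

theorem IsOddC1.integral_difference_mul_cos {f : ℝ → ℝ} (hf : IsOddC1 f) (k : ℕ) (s : ℝ) :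
    ∫ θ in (-π)..π, (f (θ - s) - f (θ + s)) * cos (k * θ)
      = -(2 * sin (k * s)) * sineCoeff f k := by
  have hc := hf.continuous
  have e1 := integral_shift (h := fun θ => f (θ - s) * cos (k * θ))
    (fun x => by
      simp only
      rw [show x + 2 * π - s = x - s + 2 * π by ring, hf.periodic,
        show cos (k * (x + 2 * π)) = cos (k * x) from periodic_cos_nat k x]) s
  have e2 := integral_shift (h := fun θ => f (θ + s) * cos (k * θ))
    (fun x => by
      simp only
      rw [show x + 2 * π + s = x + s + 2 * π by ring, hf.periodic,
        show cos (k * (x + 2 * π)) = cos (k * x) from periodic_cos_nat k x]) (-s)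
  simp only [add_sub_cancel_right, neg_add_cancel_right] at e1 e2
  have e3 : ∫ θ in (-π)..π, (f (θ - s) - f (θ + s)) * cos (k * θ)
      = (∫ θ in (-π)..π, f (θ - s) * cos (k * θ)) - ∫ θ in (-π)..π, f (θ + s) * cos (k * θ) := by
    rw [← intervalIntegral.integral_sub]
    · simp only [sub_mul]
    · exact (by fun_prop : Continuous _).intervalIntegrable _ _
    · exact (by fun_prop : Continuous _).intervalIntegrable _ _
  rw [e3, ← e1, ← e2, ← intervalIntegral.integral_sub, sineCoeff,
    ← intervalIntegral.integral_const_mul]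
  · refine intervalIntegral.integral_congr fun θ _ => ?_
    rw [show (k : ℝ) * (θ + s) = k * θ + k * s by ring,
      show (k : ℝ) * (θ + -s) = k * θ - k * s by ring, cos_add, cos_sub]
    ring
  · exact (by fun_prop : Continuous _).intervalIntegrable _ _
  · exact (by fun_prop : Continuous _).intervalIntegrable _ _

/-- Fubini applies because the symmetrized kernel is bounded; the inner θ-integral is then evaluated
by translation invariance. -/
theorem IsOddC1.integral_hilbertInt_mul_cos {f : ℝ → ℝ} (hf : IsOddC1 f) (k : ℕ) :
    ∫ θ in (-π)..π, hilbertInt f θ * cos (k * θ)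
      = -(1 / π * ∫ s in (0 : ℝ)..π, Real.cot (s / 2) * sin (k * s)) * sineCoeff f k := by
  obtain ⟨C, hC⟩ := hf.exists_kernel_bound
  have hpi : (-π) ≤ π := by linarith [pi_pos]
  have e1 : ∫ θ in (-π)..π, hilbertInt f θ * cos (k * θ)
      = 1 / (2 * π) * ∫ θ in (-π)..π, ∫ s in (0 : ℝ)..π, hilbertKernel f θ s * cos (k * θ) := by
    rw [← intervalIntegral.integral_const_mul]
    refine intervalIntegral.integral_congr fun θ _ => ?_
    rw [intervalIntegral.integral_mul_const, hilbertInt]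
    ring
  have e2 : ∫ θ in (-π)..π, ∫ s in (0 : ℝ)..π, hilbertKernel f θ s * cos (k * θ)
      = ∫ s in (0 : ℝ)..π, ∫ θ in (-π)..π, hilbertKernel f θ s * cos (k * θ) := by
    refine intervalIntegral_intervalIntegral_swap ?_
    rw [uIoc_of_le hpi, uIoc_of_le pi_pos.le]
    refine Measure.integrableOn_of_bounded (M := C) ?_ ?_ ?_
    · rw [Measure.volume_eq_prod, Measure.prod_prod]
      simp [ENNReal.mul_eq_top]
    · refine Measurable.aestronglyMeasurable ?_
      exact (measurable_hilbertKernel hf.continuous).mul (by fun_prop)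
    · refine (ae_restrict_mem (measurableSet_Ioc.prod measurableSet_Ioc)).mono fun p hp => ?_
      simp only [Function.uncurry]
      rw [norm_mul, Real.norm_eq_abs, Real.norm_eq_abs]
      have := hC p.1 p.2 hp.2
      calc |hilbertKernel f p.1 p.2| * |cos (k * p.1)| ≤ |hilbertKernel f p.1 p.2| * 1 :=
            mul_le_mul_of_nonneg_left (abs_cos_le_one _) (abs_nonneg _)
        _ ≤ C := by linarith
  have e3 : ∀ s, ∫ θ in (-π)..π, hilbertKernel f θ s * cos (k * θ)
      = -2 * sineCoeff f k * (Real.cot (s / 2) * sin (k * s)) := by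
    intro s
    simp only [hilbertKernel, mul_assoc]
    rw [intervalIntegral.integral_const_mul, hf.integral_difference_mul_cos]
    ring
  rw [e1, e2]
  simp only [e3]
  rw [intervalIntegral.integral_const_mul]
  ring

theorem IsOddC1.integral_hilbertInt_mul_cos_succ {f : ℝ → ℝ} (hf : IsOddC1 f) (k : ℕ) :
    ∫ θ in (-π)..π, hilbertInt f θ * cos ((k + 1 : ℕ) * θ) = -sineCoeff f (k + 1) := by
  rw [hf.integral_hilbertInt_mul_cos, (integral_cot_half_mul_sin k).2]
  field_simp

theorem IsOddC1.integral_hilbertInt {f : ℝ → ℝ} (hf : IsOddC1 f) :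
    ∫ θ in (-π)..π, hilbertInt f θ = 0 := by
  have := hf.integral_hilbertInt_mul_cos 0
  simpa [sineCoeff] using this

/-! ### The velocity -/

theorem IsOddC1.hasDerivAt_velocity {f : ℝ → ℝ} (hf : IsOddC1 f) (θ : ℝ) :
    HasDerivAt (velocity f) (hilbertInt f θ) θ := by
  have : velocity f = fun θ => ∫ ϑ in (0 : ℝ)..θ, hilbertInt f ϑ := by
    funext θ; rw [velocity, hf.hilbert_eq]
  rw [this]
  exact intervalIntegral.integral_hasDerivAt_right
    (hf.continuous_hilbertInt.intervalIntegrable _ _)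
    (hf.continuous_hilbertInt.stronglyMeasurableAtFilter _ _) hf.continuous_hilbertInt.continuousAt

theorem IsOddC1.velocity_odd {f : ℝ → ℝ} (hf : IsOddC1 f) : Function.Odd (velocity f) := by
  intro θ
  unfold velocity
  rw [hf.hilbert_eq]
  have := intervalIntegral.integral_comp_neg (a := 0) (b := θ) (hilbertInt f)
  simp only [hf.hilbertInt_even, neg_zero] at this
  rw [this, intervalIntegral.integral_symm]

/-- The stream-type function `f / 2 + v(f)`. -/
def potential (f : ℝ → ℝ) (θ : ℝ) : ℝ := 1 / 2 * f θ + velocity f θ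

theorem IsOddC1.hasDerivAt_potential {f : ℝ → ℝ} (hf : IsOddC1 f) (θ : ℝ) :
    HasDerivAt (potential f) (1 / 2 * deriv f θ + hilbertInt f θ) θ :=
  ((hf.hasDerivAt θ).const_mul _).add (hf.hasDerivAt_velocity θ)

theorem IsOddC1.potential_odd {f : ℝ → ℝ} (hf : IsOddC1 f) : Function.Odd (potential f) := by
  intro θ
  simp only [potential, hf.odd θ, hf.velocity_odd θ]
  ring

theorem IsOddC1.apply_pi {f : ℝ → ℝ} (hf : IsOddC1 f) : f π = 0 := by
  have h1 := hf.periodic (-π)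
  have h2 := hf.odd π
  rw [show -π + 2 * π = π by ring] at h1
  linarith

/-- Hf has mean zero, so the odd function v(f) takes equal values at ±π. This removes the boundary
terms in later integrations by parts. -/
theorem IsOddC1.potential_pi {f : ℝ → ℝ} (hf : IsOddC1 f) : potential f π = 0 := by
  have h1 : ∫ θ in (-π)..π, hilbertInt f θ = velocity f π - velocity f (-π) :=
    intervalIntegral.integral_eq_sub_of_hasDerivAt (fun θ _ => hf.hasDerivAt_velocity θ)
      (hf.continuous_hilbertInt.intervalIntegrable _ _)
  rw [hf.integral_hilbertInt, hf.velocity_odd π] at h1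
  rw [potential, hf.apply_pi]
  linarith

/-- Integration by parts against a cosine for an odd function vanishing at `π`. -/
theorem integral_deriv_mul_cos {F F' : ℝ → ℝ} (hF : ∀ θ, HasDerivAt F (F' θ) θ)
    (hF' : Continuous F') (hodd : Function.Odd F) (hpi : F π = 0) (k : ℕ) :
    ∫ θ in (-π)..π, F' θ * cos (k * θ) = k * sineCoeff F k := by
  have hF0 : F (-π) = 0 := by rw [hodd, hpi, neg_zero]
  have hv : ∀ θ : ℝ, HasDerivAt (fun x : ℝ => cos (k * x)) (-(k * sin (k * θ))) θ := fun θ => by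
    have := ((hasDerivAt_id θ).const_mul (k : ℝ)).cos
    simp only [mul_one, id] at this
    convert this using 1
    ring
  have := intervalIntegral.integral_mul_deriv_eq_deriv_mul (a := -π) (b := π)
    (fun θ _ => hv θ) (fun θ _ => hF θ)
    ((by fun_prop : Continuous fun θ : ℝ => -(k * sin (k * θ))).intervalIntegrable _ _)
    (hF'.intervalIntegrable _ _)
  simp only [hpi, hF0, mul_zero, sub_zero, zero_sub] at this
  rw [sineCoeff, ← intervalIntegral.integral_const_mul]
  simp only [mul_comm (F' _)]
  rw [this, ← intervalIntegral.integral_neg]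
  refine intervalIntegral.integral_congr fun θ _ => ?_
  ring

/-! ### Sine coefficients of `L⁺ f` -/

theorem IsOddC1.sineCoeff_potential {f : ℝ → ℝ} (hf : IsOddC1 f) (k : ℕ) :
    sineCoeff (potential f) k = (1 / 2 - 1 / k) * sineCoeff f k := by
  rcases k with _ | k
  · simp [sineCoeff]
  have h1 := integral_deriv_mul_cos hf.hasDerivAt_potential
    ((hf.continuous_deriv.const_smul (1 / 2 : ℝ)).add hf.continuous_hilbertInt)
    hf.potential_odd hf.potential_pi (k + 1)
  have h2 := integral_deriv_mul_cos hf.hasDerivAt hf.continuous_deriv hf.odd hf.apply_pi (k + 1)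
  have h3 := hf.integral_hilbertInt_mul_cos_succ k
  have hd := hf.continuous_deriv
  have hh := hf.continuous_hilbertInt
  have h4 : ∫ θ in (-π)..π, (1 / 2 * deriv f θ + hilbertInt f θ) * cos ((k + 1 : ℕ) * θ)
      = 1 / 2 * (∫ θ in (-π)..π, deriv f θ * cos ((k + 1 : ℕ) * θ))
        + ∫ θ in (-π)..π, hilbertInt f θ * cos ((k + 1 : ℕ) * θ) := by
    rw [← intervalIntegral.integral_const_mul, ← intervalIntegral.integral_add]
    · refine intervalIntegral.integral_congr fun θ _ => ?_
      ring
    · exact (by fun_prop : Continuous _).intervalIntegrable _ _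
    · exact (by fun_prop : Continuous _).intervalIntegrable _ _
  rw [h4, h2, h3] at h1
  have hk : ((k + 1 : ℕ) : ℝ) ≠ 0 := by positivity
  field_simp
  linear_combination -2 * h1

theorem IsOddC1.Lplus_eq {f : ℝ → ℝ} (hf : IsOddC1 f) (θ : ℝ) :
    Lplus f θ = potential f θ * (2 * cos (2 * θ))
      - sin (2 * θ) * (1 / 2 * deriv f θ + hilbertInt f θ) := by
  have h1 : deriv (fun θ : ℝ => sin (2 * θ)) θ = 2 * cos (2 * θ) := by
    have := (((hasDerivAt_id θ).const_mul (2 : ℝ)).sin).deriv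
    simp only [mul_one, id] at this
    rw [this, mul_comm]
  have h2 := (hf.hasDerivAt_potential θ).deriv
  rw [Lplus, bracket, h1]
  rw [show (fun θ => 1 / 2 * f θ + velocity f θ) = potential f from rfl, h2]
  rfl

theorem IsOddC1.continuous_potential {f : ℝ → ℝ} (hf : IsOddC1 f) : Continuous (potential f) :=
  continuous_iff_continuousAt.2 fun θ => (hf.hasDerivAt_potential θ).continuousAt

theorem IsOddC1.continuous_Lplus {f : ℝ → ℝ} (hf : IsOddC1 f) : Continuous (Lplus f) := by
  rw [funext hf.Lplus_eq]
  have h1 := hf.continuous_potential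
  have h2 := hf.continuous_deriv
  have h3 := hf.continuous_hilbertInt
  fun_prop

theorem IsOddC1.Lplus_odd {f : ℝ → ℝ} (hf : IsOddC1 f) : Function.Odd (Lplus f) := by
  intro θ
  rw [hf.Lplus_eq, hf.Lplus_eq, hf.potential_odd, hf.deriv_even, hf.hilbertInt_even]
  rw [show 2 * -θ = -(2 * θ) by ring, cos_neg, sin_neg]
  ring

/-- The derivative in the bracket is moved onto sin 2θ sin kθ. The lower frequency k - 2 is kept
real because it is negative for k = 1. -/
theorem IsOddC1.sineCoeff_Lplus_aux {f : ℝ → ℝ} (hf : IsOddC1 f) (k : ℕ) :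
    sineCoeff (Lplus f) k = (2 + k / 2) * sineCoeff (potential f) (k + 2)
      + (2 - k / 2) * ∫ θ in (-π)..π, potential f θ * sin (((k : ℝ) - 2) * θ) := by
  have h1 := hf.continuous_potential
  have h2 := hf.continuous_deriv
  have h3 := hf.continuous_hilbertInt
  have hv : ∀ θ : ℝ, HasDerivAt (fun x : ℝ => sin (2 * x) * sin (k * x))
      (2 * cos (2 * θ) * sin (k * θ) + sin (2 * θ) * (k * cos (k * θ))) θ := fun θ => by
    have a1 := ((hasDerivAt_id θ).const_mul (k : ℝ)).sin
    have a2 := ((hasDerivAt_id θ).const_mul (2 : ℝ)).sin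
    simp only [mul_one, id] at a1 a2
    refine (a2.fun_mul a1).congr_deriv ?_
    ring
  have hp0 : potential f (-π) = 0 := by rw [hf.potential_odd, hf.potential_pi, neg_zero]
  have ibp := intervalIntegral.integral_mul_deriv_eq_deriv_mul (a := -π) (b := π)
    (fun θ _ => hv θ) (fun θ _ => hf.hasDerivAt_potential θ)
    ((by fun_prop : Continuous fun θ : ℝ => 2 * cos (2 * θ) * sin (k * θ)
      + sin (2 * θ) * (k * cos (k * θ))).intervalIntegrable _ _)
    ((by fun_prop : Continuous fun θ : ℝ => 1 / 2 * deriv f θ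
      + hilbertInt f θ).intervalIntegrable _ _)
  simp only [hf.potential_pi, hp0, mul_zero, sub_zero, zero_sub] at ibp
  have e1 : sineCoeff (Lplus f) k
      = (∫ θ in (-π)..π, potential f θ * (2 * cos (2 * θ)) * sin (k * θ))
        - ∫ θ in (-π)..π, sin (2 * θ) * sin (k * θ) * (1 / 2 * deriv f θ + hilbertInt f θ) := by
    rw [← intervalIntegral.integral_sub, sineCoeff]
    · refine intervalIntegral.integral_congr fun θ _ => ?_
      rw [hf.Lplus_eq]
      ring
    · exact (by fun_prop : Continuous _).intervalIntegrable _ _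
    · exact (by fun_prop : Continuous _).intervalIntegrable _ _
  rw [e1, ibp, sub_neg_eq_add, ← intervalIntegral.integral_add, sineCoeff,
    ← intervalIntegral.integral_const_mul, ← intervalIntegral.integral_const_mul,
    ← intervalIntegral.integral_add]
  · refine intervalIntegral.integral_congr fun θ _ => ?_
    rw [show ((k + 2 : ℕ) : ℝ) * θ = k * θ + 2 * θ by push_cast; ring,
      show ((k : ℝ) - 2) * θ = k * θ - 2 * θ by ring, sin_add, sin_sub]
    ring
  all_goals exact (by fun_prop : Continuous _).intervalIntegrable _ _

/-- Frequency -1 folds back onto 1 with a change of sign. The resulting 3/4 is `amp 1`, which makes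
the first diagonal entry of the matrix positive. -/
theorem IsOddC1.sineCoeff_Lplus_one {f : ℝ → ℝ} (hf : IsOddC1 f) :
    sineCoeff (Lplus f) 1 = 5 / 12 * sineCoeff f 3 + 3 / 4 * sineCoeff f 1 := by
  have h : ∫ θ in (-π)..π, potential f θ * sin ((((1 : ℕ) : ℝ) - 2) * θ)
      = -sineCoeff (potential f) 1 := by
    rw [sineCoeff, ← intervalIntegral.integral_neg]
    refine intervalIntegral.integral_congr fun θ _ => ?_
    rw [show (((1 : ℕ) : ℝ) - 2) * θ = -(((1 : ℕ) : ℝ) * θ) by push_cast; ring, sin_neg]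
    ring
  rw [hf.sineCoeff_Lplus_aux, h, hf.sineCoeff_potential, hf.sineCoeff_potential]
  norm_num
  ring

theorem IsOddC1.sineCoeff_Lplus_add_two {f : ℝ → ℝ} (hf : IsOddC1 f) (q : ℕ) :
    sineCoeff (Lplus f) (q + 2)
      = (3 + q / 2) * (1 / 2 - 1 / (q + 4)) * sineCoeff f (q + 4)
        + (1 - q / 2) * (1 / 2 - 1 / q) * sineCoeff f q := by
  have h : ∫ θ in (-π)..π, potential f θ * sin ((((q + 2 : ℕ) : ℝ) - 2) * θ)
      = sineCoeff (potential f) q := by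
    simp [sineCoeff]
  rw [hf.sineCoeff_Lplus_aux, h, hf.sineCoeff_potential, hf.sineCoeff_potential]
  push_cast
  rw [show (q : ℝ) + 2 + 2 = q + 4 by ring]
  ring

/-! ### Trigonometric functionals on `L²(𝕋)` -/

theorem memLp_of_abs_le {φ : ℝ → ℝ} (hφ : Measurable φ) {C : ℝ} (hC : ∀ x, |φ x| ≤ C) :
    MemLp φ 2 torusMeasure :=
  MemLp.of_bound hφ.aestronglyMeasurable C (Eventually.of_forall hC)

theorem memLp_sin (a : ℝ) : MemLp (fun θ => sin (a * θ)) 2 torusMeasure :=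
  memLp_of_abs_le (by fun_prop) fun _ => abs_sin_le_one _

theorem memLp_cos (a : ℝ) : MemLp (fun θ => cos (a * θ)) 2 torusMeasure :=
  memLp_of_abs_le (by fun_prop) fun _ => abs_cos_le_one _

theorem inner_toLp {φ : ℝ → ℝ} (hφ : MemLp φ 2 torusMeasure) (u : L2) :
    inner ℝ (hφ.toLp φ) u = ∫ θ, u θ * φ θ ∂torusMeasure := by
  rw [L2.inner_def]
  refine integral_congr_ae (hφ.coeFn_toLp.mono fun θ hθ => ?_)
  simp only [hθ]
  rfl

theorem integral_torus (h : ℝ → ℝ) : ∫ θ, h θ ∂torusMeasure = ∫ θ in (-π)..π, h θ := by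
  rw [intervalIntegral.integral_of_le (by linarith [pi_pos])]

/-- The functional `u ↦ ∫ u sin (n - 1)θ`. -/
def sinFun (n : ℕ) : L2 →L[ℝ] ℝ := innerSL ℝ ((memLp_sin ((n : ℝ) - 1)).toLp _)

/-- The functional `u ↦ ∫ u cos nθ`. -/
def cosFun (n : ℕ) : L2 →L[ℝ] ℝ := innerSL ℝ ((memLp_cos n).toLp _)

theorem sinFun_apply (n : ℕ) (u : L2) :
    sinFun n u = ∫ θ, u θ * sin (((n : ℝ) - 1) * θ) ∂torusMeasure :=
  inner_toLp (memLp_sin _) u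

theorem cosFun_apply (n : ℕ) (u : L2) :
    cosFun n u = ∫ θ, u θ * cos (n * θ) ∂torusMeasure :=
  inner_toLp (memLp_cos _) u

theorem sinFun_one (u : L2) : sinFun 1 u = 0 := by
  rw [sinFun_apply]; simp

theorem norm_sq_eq (u : L2) : ‖u‖ ^ 2 = ∫ θ, u θ ^ 2 ∂torusMeasure := by
  rw [← real_inner_self_eq_norm_sq, L2.inner_def]
  refine integral_congr_ae (Eventually.of_forall fun θ => ?_)
  simp only [real_inner_self_eq_norm_sq, Real.norm_eq_abs, sq_abs]

theorem integrable_mul_L2 (u : L2) {φ : ℝ → ℝ} (hφ : MemLp φ 2 torusMeasure) :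
    Integrable (fun θ => u θ * φ θ) torusMeasure :=
  (Lp.memLp u).integrable_mul hφ

theorem fourierCoeffOn_ofReal (u : L2) (n : ℤ) :
    fourierCoeffOn (neg_lt_self pi_pos) (fun θ => (u θ : ℂ)) n
      = (1 / (2 * π) : ℝ) • (((∫ θ, u θ * cos (n * θ) ∂torusMeasure : ℝ) : ℂ)
        - ((∫ θ, u θ * sin (n * θ) ∂torusMeasure : ℝ) : ℂ) * Complex.I) := by
  rw [fourierCoeffOn_eq_integral, intervalIntegral.integral_of_le (by linarith [pi_pos])]
  congr 1
  · rw [show π - -π = 2 * π by ring]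
  have i1 := (integrable_mul_L2 u (memLp_cos n)).ofReal (𝕜 := ℂ)
  have i2 := ((integrable_mul_L2 u (memLp_sin n)).ofReal (𝕜 := ℂ)).mul_const Complex.I
  rw [← integral_complex_ofReal, ← integral_complex_ofReal, ← integral_mul_const]
  refine Eq.trans ?_ (integral_sub i1 i2)
  refine integral_congr_ae (Eventually.of_forall fun θ => ?_)
  simp only [fourier_coe_apply, smul_eq_mul]
  have : (2 * (π : ℂ) * Complex.I * ((-n : ℤ) : ℂ) * (θ : ℂ) / ((π - -π : ℝ) : ℂ))
      = ((-(n * θ) : ℝ) : ℂ) * Complex.I := by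
    have hp : (π : ℂ) ≠ 0 := by exact_mod_cast pi_ne_zero
    push_cast
    rw [show (π : ℂ) - -π = 2 * π by ring]
    field_simp
  rw [this, Complex.exp_mul_I, ← Complex.ofReal_cos, ← Complex.ofReal_sin, cos_neg, sin_neg]
  push_cast
  ring

theorem parseval_sq (u : L2) (hu : ∀ n, cosFun n u = 0) :
    HasSum (fun p => sinFun (p + 2) u ^ 2) (π * ‖u‖ ^ 2) := by
  have hm : MemLp (fun θ => (u θ : ℂ)) 2 (volume.restrict (Ioc (-π) π)) := (Lp.memLp u).ofReal
  have h := hasSum_sq_fourierCoeffOn (neg_lt_self pi_pos) hm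
  have hc : ∀ n : ℤ, ∫ θ, u θ * cos (n * θ) ∂torusMeasure = 0 := by
    intro n
    rcases Int.eq_nat_or_neg n with ⟨m, rfl | rfl⟩
    · simpa [cosFun_apply] using hu m
    · simpa [cosFun_apply, cos_neg] using hu m
  have hs : ∀ n : ℤ, ‖fourierCoeffOn (neg_lt_self pi_pos) (fun θ => (u θ : ℂ)) n‖ ^ 2
      = (∫ θ, u θ * sin (n * θ) ∂torusMeasure) ^ 2 / (4 * π ^ 2) := by
    intro n
    rw [fourierCoeffOn_ofReal, hc, norm_smul, Complex.ofReal_zero, zero_sub, norm_neg, norm_mul,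
      Complex.norm_I, mul_one, Complex.norm_real, mul_pow, Real.norm_eq_abs, Real.norm_eq_abs,
      sq_abs, sq_abs]
    field_simp
    ring
  have hn : ∫ θ in (-π)..π, ‖(u θ : ℂ)‖ ^ 2 = ‖u‖ ^ 2 := by
    rw [norm_sq_eq, intervalIntegral.integral_of_le (by linarith [pi_pos])]
    simp only [Complex.norm_real, Real.norm_eq_abs, sq_abs]
  simp only [hs, hn] at h
  -- Pairing n with -n counts n = 0 twice, but that sine term vanishes. The factor 2π² compensates
  -- for the coefficients being squared sine integrals over 4π².
  have h2 := (h.nat_add_neg.mul_left (2 * π ^ 2))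
  have h3 := (hasSum_nat_add_iff' 1).2 h2
  convert! h3 using 1
  · funext p
    rw [sinFun_apply]
    have e1 : ∫ θ, u θ * sin (((-((p + 1 : ℕ) : ℤ) : ℤ) : ℝ) * θ) ∂torusMeasure
        = - ∫ θ, u θ * sin ((((p + 1 : ℕ) : ℤ) : ℝ) * θ) ∂torusMeasure := by
      rw [← integral_neg]
      refine integral_congr_ae (Eventually.of_forall fun θ => ?_)
      simp only [Int.cast_neg, neg_mul, sin_neg, mul_neg]
    rw [e1, neg_sq]
    have e2 : (((p + 2 : ℕ) : ℝ) - 1) = (((p + 1 : ℕ) : ℤ) : ℝ) := by push_cast; ring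
    rw [e2]
    field_simp
    ring
  · simp
    field_simp
    ring

/-- Parseval's identity for the inner product of two odd functions. -/
theorem parseval_inner (u v : L2) (hu : ∀ n, cosFun n u = 0) (hv : ∀ n, cosFun n v = 0) :
    HasSum (fun p => sinFun (p + 2) u * sinFun (p + 2) v) (π * inner ℝ u v) := by
  have h1 := parseval_sq (u + v) fun n => by rw [map_add, hu, hv, add_zero]
  have h2 := parseval_sq (u - v) fun n => by rw [map_sub, hu, hv, sub_zero]
  have h3 := (h1.sub h2).mul_left (1 / 4)
  convert! h3 using 1
  · funext p
    simp only [map_add, map_sub]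
    ring
  · rw [norm_add_sq_real, norm_sub_sq_real]
    ring

/-! ### Primitives -/

/-- The primitive `G_u(θ) = ∫₀^θ 2√π sin s u(s) ds`. -/
def primitive (u : L2) (θ : ℝ) : ℝ := ∫ s in (0 : ℝ)..θ, u s * (2 * √π * sin s)

theorem intervalIntegrable_weight (u : L2) :
    IntervalIntegrable (fun s => u s * (2 * √π * sin s)) volume (-π) π := by
  rw [intervalIntegrable_iff_integrableOn_Ioc_of_le (by linarith [pi_pos])]
  exact integrable_mul_of_continuous u (by fun_prop)

theorem primitive_ae_hasDerivAt (u : L2) :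
    ∀ᵐ θ, θ ∈ uIcc (-π) π → HasDerivAt (primitive u) (u θ * (2 * √π * sin θ)) θ := by
  filter_upwards [(intervalIntegrable_weight u).ae_hasDerivAt_integral] with θ hθ hm
  exact hθ hm 0 (by rw [uIcc_of_le (by linarith [pi_pos])]; constructor <;> linarith [pi_pos])

theorem primitive_ac (u : L2) : AbsolutelyContinuousOnInterval (primitive u) (-π) π :=
  (intervalIntegrable_weight u).absolutelyContinuousOnInterval_intervalIntegral
    (by rw [uIcc_of_le (by linarith [pi_pos])]; constructor <;> linarith [pi_pos])

theorem primitive_continuousOn (u : L2) : ContinuousOn (primitive u) (Icc (-π) π) := by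
  have := (primitive_ac u).continuousOn
  rwa [uIcc_of_le (by linarith [pi_pos])] at this

theorem primitive_pi_sub (u : L2) :
    primitive u π - primitive u (-π) = 2 * √π * sinFun 2 u := by
  have hi := intervalIntegrable_weight u
  have h0 : (0 : ℝ) ∈ uIcc (-π) π := by
    rw [uIcc_of_le (by linarith [pi_pos])]; constructor <;> linarith [pi_pos]
  unfold primitive
  rw [intervalIntegral.integral_interval_sub_left, sinFun_apply, integral_torus,
    ← intervalIntegral.integral_const_mul]
  · refine intervalIntegral.integral_congr fun θ _ => ?_
    rw [show (((2 : ℕ) : ℝ) - 1) * θ = θ by push_cast; ring]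
    ring
  · exact hi.mono_set (uIcc_subset_uIcc h0 right_mem_uIcc)
  · exact hi.mono_set (uIcc_subset_uIcc h0 left_mem_uIcc)

/-- Integration by parts, then 2 sin θ cos kθ = sin (k+1)θ - sin (k-1)θ. The condition on `sinFun 2`
says that the primitive takes equal values at ±π. -/
theorem sineCoeff_primitive (u : L2) (hu : sinFun 2 u = 0) (k : ℕ) :
    k * sineCoeff (primitive u) k = √π * (sinFun (k + 2) u - sinFun k u) := by
  have hcos : AbsolutelyContinuousOnInterval (fun x : ℝ => cos (k * x)) (-π) π :=
    ContDiffOn.absolutelyContinuousOnInterval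
      ((by fun_prop : ContDiff ℝ 1 fun x : ℝ => cos (k * x)).contDiffOn)
  have ibp := (primitive_ac u).integral_mul_deriv_eq_deriv_mul hcos
  have hd : ∀ θ : ℝ, deriv (fun x : ℝ => cos (k * x)) θ = -(k * sin (k * θ)) := fun θ => by
    have := ((hasDerivAt_id θ).const_mul (k : ℝ)).cos
    simp only [mul_one, id] at this
    rw [this.deriv]
    ring
  have hb : primitive u π * cos (k * π) - primitive u (-π) * cos (k * -π) = 0 := by
    rw [mul_neg, cos_neg, ← sub_mul, primitive_pi_sub, hu]
    ring
  rw [hb, zero_sub] at ibp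
  have e1 : ∫ x in (-π)..π, deriv (primitive u) x * cos (k * x)
      = ∫ x in (-π)..π, u x * (2 * √π * sin x) * cos (k * x) := by
    refine intervalIntegral.integral_congr_ae ?_
    filter_upwards [primitive_ae_hasDerivAt u] with x hx hm
    rw [(hx (uIoc_subset_uIcc hm)).deriv]
  rw [e1] at ibp
  simp only [hd] at ibp
  have e2 : k * sineCoeff (primitive u) k
      = -∫ x in (-π)..π, primitive u x * -(k * sin (k * x)) := by
    rw [sineCoeff, ← intervalIntegral.integral_const_mul, ← intervalIntegral.integral_neg]
    refine intervalIntegral.integral_congr fun θ _ => ?_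
    ring
  rw [e2, ibp, neg_neg, sinFun_apply, sinFun_apply, ← integral_torus,
    ← integral_sub (integrable_mul_L2 u (memLp_sin _)) (integrable_mul_L2 u (memLp_sin _)),
    ← integral_const_mul]
  refine integral_congr_ae (Eventually.of_forall fun θ => ?_)
  simp only
  rw [show (((k + 2 : ℕ) : ℝ) - 1) * θ = k * θ + θ by push_cast; ring,
    show ((k : ℝ) - 1) * θ = k * θ - θ by ring, sin_add, sin_sub]
  ring

/-- For `θ ∈ [-π, π]` the value `G_u(θ)` is a bounded functional of `u`. -/
theorem exists_primitive_functional {θ : ℝ} (hθ : θ ∈ Icc (-π) π) :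
    ∃ Φ : L2 →L[ℝ] ℝ, ∀ u, Φ u = primitive u θ := by
  have bd : ∀ s : Set ℝ, MeasurableSet s →
      MemLp (s.indicator fun s => 2 * √π * sin s) 2 torusMeasure := fun s hs =>
    (memLp_of_abs_le (C := |2 * √π|) (by fun_prop) fun x => by
      rw [abs_mul]
      exact mul_le_of_le_one_right (abs_nonneg _) (abs_sin_le_one _)).indicator hs
  have key : ∀ a b : ℝ, -π ≤ a → b ≤ π → ∀ u : L2,
      innerSL ℝ ((bd (Ioc a b) measurableSet_Ioc).toLp _) u
        = ∫ s in Ioc a b, u s * (2 * √π * sin s) := by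
    intro a b ha hb u
    rw [innerSL_apply_apply, inner_toLp]
    have : (fun θ => u θ * (Ioc a b).indicator (fun s => 2 * √π * sin s) θ)
        = (Ioc a b).indicator fun s => u s * (2 * √π * sin s) := by
      funext x
      by_cases hx : x ∈ Ioc a b <;> simp [hx]
    rw [this, integral_indicator measurableSet_Ioc, Measure.restrict_restrict measurableSet_Ioc,
      inter_eq_left.2 (Ioc_subset_Ioc ha hb)]
  rcases le_total 0 θ with h | h
  · refine ⟨_, fun u => (key 0 θ (by linarith [pi_pos]) hθ.2 u).trans ?_⟩
    rw [primitive, intervalIntegral.integral_of_le h]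
  · refine ⟨-innerSL ℝ ((bd (Ioc θ 0) measurableSet_Ioc).toLp _), fun u => ?_⟩
    rw [neg_apply, key θ 0 hθ.1 (by linarith [pi_pos]) u]
    rw [primitive, intervalIntegral.integral_of_ge h]

/-! ### Functions represented by their weighted derivative -/

theorem ae_sin_ne_zero : ∀ᵐ θ ∂torusMeasure, sin θ ≠ 0 := by
  have h1 : ∀ᵐ θ : ℝ, θ ≠ 0 := by simp [ae_iff, measure_singleton]
  have h2 : ∀ᵐ θ : ℝ, θ ≠ π := by simp [ae_iff, measure_singleton]
  filter_upwards [ae_restrict_of_ae h1, ae_restrict_of_ae h2, ae_restrict_mem measurableSet_Ioc]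
    with θ a b c
  intro h
  exact a ((sin_eq_zero_iff_of_lt_of_lt c.1 (lt_of_le_of_ne c.2 b)).1 h)

theorem ae_deriv_eq {f : ℝ → ℝ} {u : L2} (hu : (u : ℝ → ℝ) =ᵐ[torusMeasure] weightedDeriv f) :
    ∀ᵐ θ ∂torusMeasure, u θ * (2 * √π * sin θ) = deriv f θ := by
  filter_upwards [hu, ae_sin_ne_zero] with θ h1 h2
  have : √π ≠ 0 := (Real.sqrt_pos.2 pi_pos).ne'
  rw [h1, weightedDeriv]
  field_simp

theorem uIcc_pi : uIcc (-π) π = Icc (-π) π := uIcc_of_le (by linarith [pi_pos])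

theorem IsOddC1.primitive_eq {f : ℝ → ℝ} (hf : IsOddC1 f) {u : L2}
    (hu : (u : ℝ → ℝ) =ᵐ[torusMeasure] weightedDeriv f) {θ : ℝ} (hθ : θ ∈ Icc (-π) π) :
    primitive u θ = f θ := by
  have h0 : f 0 = 0 := by
    have := hf.odd 0
    rw [neg_zero] at this
    linarith
  have h1 : ∫ s in (0 : ℝ)..θ, deriv f s = f θ - f 0 :=
    intervalIntegral.integral_eq_sub_of_hasDerivAt (fun s _ => hf.hasDerivAt s)
      (hf.continuous_deriv.intervalIntegrable _ _)
  rw [← sub_zero (f θ), ← h0, ← h1, primitive]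
  refine intervalIntegral.integral_congr_ae ?_
  filter_upwards [ae_imp_of_ae_restrict (ae_deriv_eq hu)] with s hs hm
  refine hs ?_
  rcases mem_uIoc.1 hm with ⟨a, b⟩ | ⟨a, b⟩
  · exact ⟨by linarith [pi_pos], b.trans hθ.2⟩
  · exact ⟨hθ.1.trans_lt a, by linarith [pi_pos]⟩

theorem IsOddC1.sinFun_two {f : ℝ → ℝ} (hf : IsOddC1 f) {u : L2}
    (hu : (u : ℝ → ℝ) =ᵐ[torusMeasure] weightedDeriv f) : sinFun 2 u = 0 := by
  have h := primitive_pi_sub u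
  rw [hf.primitive_eq hu ⟨by linarith [pi_pos], le_rfl⟩,
    hf.primitive_eq hu ⟨le_rfl, by linarith [pi_pos]⟩, hf.odd, hf.apply_pi] at h
  have : 2 * √π ≠ 0 := by have := Real.sqrt_pos.2 pi_pos; positivity
  have h' : 2 * √π * sinFun 2 u = 0 := by rw [← h]; ring
  exact (mul_eq_zero.1 h').resolve_left this

theorem integral_torus_odd {h : ℝ → ℝ} (hodd : ∀ θ, h (-θ) = -h θ) :
    ∫ θ, h θ ∂torusMeasure = 0 := by
  rw [integral_torus]
  have := intervalIntegral.integral_comp_neg (a := -π) (b := π) h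
  simp only [hodd, neg_neg, intervalIntegral.integral_neg] at this
  linarith

theorem cosFun_eq_zero {h : ℝ → ℝ} (hodd : ∀ θ, h (-θ) = -h θ) {u : L2}
    (hu : (u : ℝ → ℝ) =ᵐ[torusMeasure] h) (n : ℕ) : cosFun n u = 0 := by
  rw [cosFun_apply]
  have : ∫ θ, u θ * cos (n * θ) ∂torusMeasure = ∫ θ, h θ * cos (n * θ) ∂torusMeasure :=
    integral_congr_ae (hu.mono fun θ hθ => by simp only [hθ])
  rw [this]
  refine integral_torus_odd fun θ => ?_
  rw [hodd, mul_neg, cos_neg]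
  ring

theorem IsOddC1.weightedDeriv_odd {f : ℝ → ℝ} (hf : IsOddC1 f) (θ : ℝ) :
    weightedDeriv f (-θ) = -weightedDeriv f θ := by
  rw [weightedDeriv, weightedDeriv, hf.deriv_even, sin_neg, mul_neg, div_neg]

theorem sineCoeff_congr {f g : ℝ → ℝ} (h : EqOn f g (Icc (-π) π)) (k : ℕ) :
    sineCoeff f k = sineCoeff g k := by
  refine intervalIntegral.integral_congr fun θ hθ => ?_
  rw [uIcc_pi] at hθ
  simp only [h hθ]

theorem IsOddC1.sineCoeff_eq {f : ℝ → ℝ} (hf : IsOddC1 f) {u : L2}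
    (hu : (u : ℝ → ℝ) =ᵐ[torusMeasure] weightedDeriv f) (k : ℕ) :
    k * sineCoeff f k = √π * (sinFun (k + 2) u - sinFun k u) := by
  rw [← sineCoeff_primitive u (hf.sinFun_two hu) k,
    sineCoeff_congr fun θ hθ => hf.primitive_eq hu hθ]

/-- The `p`-th row of the matrix of `L⁺` as a functional. -/
def rowFun (p : ℕ) : L2 →L[ℝ] ℝ :=
  amp (p + 2) • (sinFun (p + 4) - sinFun (p + 2)) + amp p • (sinFun (p + 2) - sinFun p)

theorem rowFun_apply (p : ℕ) (u : L2) : rowFun p u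
    = amp (p + 2) * (sinFun (p + 4) u - sinFun (p + 2) u)
      + amp p * (sinFun (p + 2) u - sinFun p u) := rfl

theorem IsOddC1.sineCoeff_Lplus_one_eq {f : ℝ → ℝ} (hf : IsOddC1 f) {u : L2}
    (hu : (u : ℝ → ℝ) =ᵐ[torusMeasure] weightedDeriv f) :
    sineCoeff (Lplus f) 1 = √π * rowFun 1 u := by
  have h1 := hf.sineCoeff_eq hu 1
  have h3 := hf.sineCoeff_eq hu 3
  rw [hf.sineCoeff_Lplus_one, rowFun_apply]
  norm_num [amp] at h1 h3 ⊢
  linear_combination 5 / 36 * h3 + 3 / 4 * h1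

theorem IsOddC1.sineCoeff_Lplus_add_two_eq {f : ℝ → ℝ} (hf : IsOddC1 f) {u : L2}
    (hu : (u : ℝ → ℝ) =ᵐ[torusMeasure] weightedDeriv f) (q : ℕ) :
    (q + 2) * sineCoeff (Lplus f) (q + 2) = √π * (rowFun (q + 2) u - rowFun q u) := by
  have h1 := hf.sineCoeff_eq hu q
  have h3 := hf.sineCoeff_eq hu (q + 4)
  rw [hf.sineCoeff_Lplus_add_two, rowFun_apply, rowFun_apply]
  simp only [show q + 4 + 2 = q + 6 from rfl, show q + 2 + 2 = q + 4 from rfl] at h3 ⊢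
  have e : amp (q + 4) = ((q : ℝ) + 2) ^ 2 * (q + 6) / (4 * (q + 4) ^ 2) := by
    unfold amp
    push_cast
    rw [show (q : ℝ) + 4 - 2 = q + 2 by ring, show (q : ℝ) + 4 + 2 = q + 6 by ring]
  have h3' : sineCoeff f (q + 4) = √π * (sinFun (q + 6) u - sinFun (q + 4) u) / (q + 4) := by
    rw [← h3]
    push_cast
    have : (q : ℝ) + 4 ≠ 0 := by positivity
    field_simp
  rw [h3']
  -- At q = 0 the default 1/0 = 0 is harmless since `sineCoeff f 0 = 0`; the same default gives `amp
  -- 0 = 0`.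
  rcases Nat.eq_zero_or_pos q with rfl | hq
  · have h0 : sineCoeff f 0 = 0 := by simp [sineCoeff]
    rw [h0, e]
    norm_num [amp]
    ring
  · have hq' : (q : ℝ) ≠ 0 := by positivity
    have h1' : sineCoeff f q = √π * (sinFun (q + 2) u - sinFun q u) / q := by
      rw [← h1]; field_simp
    rw [h1', e]
    unfold amp
    have : (q : ℝ) + 4 ≠ 0 := by positivity
    field_simp
    ring

/-- If `G_v = L⁺ f` with `f` represented by `u`, then the coefficients of `v` and `u` are related
by the tridiagonal matrix. -/
theorem IsOddC1.sinFun_eq_rowFun {f : ℝ → ℝ} (hf : IsOddC1 f) {u v : L2}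
    (hu : (u : ℝ → ℝ) =ᵐ[torusMeasure] weightedDeriv f) (hv : sinFun 2 v = 0)
    (h : EqOn (primitive v) (Lplus f) (Icc (-π) π)) (p : ℕ) : sinFun (p + 2) v = rowFun p u := by
  have hs : √π ≠ 0 := (Real.sqrt_pos.2 pi_pos).ne'
  induction p using Nat.twoStepInduction with
  -- Both sides vanish: `amp 2 = 0` exactly and `amp 0 = 0` by division by zero. Odd and even rows
  -- then follow separately, with steps of two.
  | zero =>
    rw [hv, rowFun_apply]
    norm_num [amp]
  | one =>
    have h1 := sineCoeff_primitive v hv 1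
    rw [sineCoeff_congr h, hf.sineCoeff_Lplus_one_eq hu, sinFun_one] at h1
    refine mul_left_cancel₀ hs ?_
    push_cast at h1
    linarith
  | more q ih _ =>
    have h1 := sineCoeff_primitive v hv (q + 2)
    push_cast at h1
    rw [sineCoeff_congr h, hf.sineCoeff_Lplus_add_two_eq hu, ih] at h1
    have := mul_left_cancel₀ hs h1
    linarith

/-- The converse passage, from rows back to sine coefficients. It serves at t = 0, where the
evolution equation is not assumed. -/
theorem IsOddC1.sineCoeff_primitive_eq {f : ℝ → ℝ} (hf : IsOddC1 f) {u v : L2}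
    (hu : (u : ℝ → ℝ) =ᵐ[torusMeasure] weightedDeriv f) (hv : sinFun 2 v = 0)
    (h : ∀ p, sinFun (p + 2) v = rowFun p u) (k : ℕ) :
    sineCoeff (primitive v) k = sineCoeff (Lplus f) k := by
  rcases k with _ | _ | q
  · simp [sineCoeff]
  · have h1 := sineCoeff_primitive v hv 1
    rw [h 1, sinFun_one] at h1
    rw [zero_add, hf.sineCoeff_Lplus_one_eq hu]
    push_cast at h1
    linarith
  · have h1 := sineCoeff_primitive v hv (q + 2)
    rw [h (q + 2), h q, ← hf.sineCoeff_Lplus_add_two_eq hu] at h1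
    push_cast at h1
    have : (q : ℝ) + 2 ≠ 0 := by positivity
    exact mul_left_cancel₀ this h1

/-- A continuous odd function on `[-π, π]` with vanishing sine coefficients is zero. -/
theorem eqOn_zero_of_sineCoeff {g : ℝ → ℝ} (hg : ContinuousOn g (Icc (-π) π))
    (hodd : ∀ θ ∈ Icc (-π) π, g (-θ) = -g θ) (h : ∀ k, sineCoeff g k = 0) :
    EqOn g 0 (Ioo (-π) π) := by
  have hpi : -π ≤ π := by linarith [pi_pos]
  set g' : ℝ → ℝ := (Icc (-π) π).indicator g with hg'
  have hm : MemLp g' 2 torusMeasure := by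
    obtain ⟨C, hC⟩ := isCompact_Icc.exists_bound_of_continuousOn hg
    have h1 : AEStronglyMeasurable g' torusMeasure :=
      ((aestronglyMeasurable_indicator_iff measurableSet_Icc).2
        (hg.aestronglyMeasurable measurableSet_Icc)).restrict
    refine MemLp.of_bound h1 |C| (Eventually.of_forall fun x => ?_)
    by_cases hx : x ∈ Icc (-π) π
    · rw [hg', indicator_of_mem hx]
      exact (hC x hx).trans (le_abs_self _)
    · rw [hg', indicator_of_notMem hx, norm_zero]
      exact abs_nonneg _
  have ho : ∀ θ, g' (-θ) = -g' θ := by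
    intro θ
    by_cases hx : θ ∈ Icc (-π) π
    · have hx' : -θ ∈ Icc (-π) π := ⟨by linarith [hx.2], by linarith [hx.1]⟩
      rw [hg', indicator_of_mem hx, indicator_of_mem hx', hodd θ hx]
    · have hx' : -θ ∉ Icc (-π) π := fun h' => hx ⟨by linarith [h'.2], by linarith [h'.1]⟩
      rw [hg', indicator_of_notMem hx, indicator_of_notMem hx', neg_zero]
  have hc := cosFun_eq_zero ho hm.coeFn_toLp
  have hs : ∀ p, sinFun (p + 2) (hm.toLp g') = 0 := by
    intro p
    rw [sinFun_apply, ← h (p + 1), sineCoeff, intervalIntegral.integral_of_le hpi]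
    refine integral_congr_ae ?_
    filter_upwards [hm.coeFn_toLp, ae_restrict_mem measurableSet_Ioc] with θ h1 h2
    rw [h1, hg', indicator_of_mem (Ioc_subset_Icc_self h2)]
    push_cast
    rw [show (p : ℝ) + 2 - 1 = p + 1 by ring]
  have hp := parseval_sq _ hc
  simp only [hs] at hp
  have h0 : ‖hm.toLp g'‖ = 0 := by
    have h1 := hp.unique (show HasSum (fun _ : ℕ => (0 : ℝ) ^ 2) 0 by simp [hasSum_zero])
    have h2 := (mul_eq_zero.1 h1).resolve_left pi_ne_zero
    exact pow_eq_zero_iff two_ne_zero |>.1 h2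
  have h1 : g' =ᵐ[torusMeasure] 0 := by
    have a := hm.coeFn_toLp
    rw [norm_eq_zero.1 h0] at a
    exact a.symm.trans (Lp.coeFn_zero ℝ 2 torusMeasure)
  have h2 : g =ᵐ[volume.restrict (Ioo (-π) π)] 0 := by
    have h3 := ae_restrict_of_ae_restrict_of_subset Ioo_subset_Ioc_self h1
    filter_upwards [h3, ae_restrict_mem measurableSet_Ioo] with θ a b
    rw [← a, hg', indicator_of_mem (Ioo_subset_Icc_self b)]
  exact Measure.eqOn_open_of_ae_eq (μ := volume) (f := g) (g := 0) h2 isOpen_Ioo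
    (hg.mono Ioo_subset_Icc_self) (continuous_const (y := (0 : ℝ))).continuousOn

/-! ### The inner product of `𝓗₂` -/

theorem rho_mul_eq {a b θ : ℝ} (hθ : sin θ ≠ 0) :
    rho θ * (a * (2 * √π * sin θ)) * (b * (2 * √π * sin θ)) = a * b := by
  have h1 : √π * √π = π := Real.mul_self_sqrt pi_pos.le
  have h2 := pi_ne_zero
  rw [rho]
  field_simp
  linear_combination 4 * a * b * h1

/-- The hypotheses concern derivatives almost everywhere, so the identity also applies to L⁺η₀,
which is not known to be C¹. -/
theorem inner2_eq {ξ η : ℝ → ℝ} {u v : L2}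
    (hu : ∀ᵐ θ ∂torusMeasure, u θ * (2 * √π * sin θ) = deriv ξ θ)
    (hv : ∀ᵐ θ ∂torusMeasure, v θ * (2 * √π * sin θ) = deriv η θ) :
    inner2 ξ η = inner ℝ u v := by
  rw [inner2, ← integral_torus, L2.inner_def]
  refine integral_congr_ae ?_
  filter_upwards [hu, hv, ae_sin_ne_zero] with θ h1 h2 h3
  rw [← h1, ← h2, rho_mul_eq h3]
  simp [mul_comm]

theorem norm2_eq {η : ℝ → ℝ} {u : L2} (hu : (u : ℝ → ℝ) =ᵐ[torusMeasure] weightedDeriv η) :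
    norm2 η = ‖u‖ := by
  have h1 := inner2_eq (ae_deriv_eq hu) (ae_deriv_eq hu)
  rw [norm2, show (∫ θ in (-π)..π, rho θ * |deriv η θ| ^ 2) = inner2 η η by
    refine intervalIntegral.integral_congr fun θ _ => ?_
    simp only [sq_abs]
    ring, h1, real_inner_self_eq_norm_sq, Real.sqrt_sq (norm_nonneg _)]

/-! ### Decay of the coefficients -/

/-- Testing the weak derivative against cos (n-1)θ bounds (n-1) times the coefficient; the remaining
factor 2 is covered by the L¹ norm of u. -/
theorem IsWeakDeriv.sinFun_decay {u u' : L2} (h : IsWeakDeriv u u') :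
    ∃ C : ℝ, ∀ n : ℕ, (n + 1) * |sinFun n u| ≤ C := by
  have bd : ∀ (w : L2) (φ : ℝ → ℝ), (∀ x, |φ x| ≤ 1) →
      |∫ θ, w θ * φ θ ∂torusMeasure| ≤ ∫ θ, |w θ| ∂torusMeasure := by
    intro w φ hφ
    have hw : Integrable (w : ℝ → ℝ) torusMeasure := (Lp.memLp w).integrable (by norm_num)
    refine norm_integral_le_of_norm_le (f := fun θ => w θ * φ θ) hw.abs
      (Eventually.of_forall fun θ => ?_)
    rw [norm_mul]
    exact mul_le_of_le_one_right (norm_nonneg _) (hφ θ)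
  refine ⟨∫ θ, |u' θ| ∂torusMeasure + 2 * ∫ θ, |u θ| ∂torusMeasure, fun n => ?_⟩
  have h0 : |sinFun n u| ≤ ∫ θ, |u θ| ∂torusMeasure := by
    rw [sinFun_apply]
    exact bd u _ fun _ => abs_sin_le_one _
  have hper : Function.Periodic (fun θ : ℝ => cos (((n : ℝ) - 1) * θ)) (2 * π) := fun x => by
    simp only
    rw [show ((n : ℝ) - 1) * (x + 2 * π) = ((n : ℝ) - 1) * x + ((n - 1 : ℤ) : ℝ) * (2 * π) by
      push_cast; ring, cos_add_int_mul_two_pi]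
  have hw := h (fun θ => cos (((n : ℝ) - 1) * θ)) (by fun_prop) hper
  have hd : ∀ θ : ℝ, deriv (fun θ : ℝ => cos (((n : ℝ) - 1) * θ)) θ
      = -((n - 1) * sin (((n : ℝ) - 1) * θ)) := fun θ => by
    have := ((hasDerivAt_id θ).const_mul ((n : ℝ) - 1)).cos
    simp only [mul_one, id] at this
    rw [this.deriv]
    ring
  have h1 : ((n : ℝ) - 1) * sinFun n u
      = ∫ θ, u' θ * cos (((n : ℝ) - 1) * θ) ∂torusMeasure := by
    rw [← neg_inj, ← hw, sinFun_apply, ← integral_const_mul, ← integral_neg]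
    refine integral_congr_ae (Eventually.of_forall fun θ => ?_)
    simp only [hd]
    ring
  have h2 : |(n : ℝ) - 1| * |sinFun n u| ≤ ∫ θ, |u' θ| ∂torusMeasure := by
    rw [← abs_mul, h1]
    exact bd u' _ fun _ => abs_cos_le_one _
  have h3 : (n : ℝ) + 1 ≤ |(n : ℝ) - 1| + 2 := by linarith [le_abs_self ((n : ℝ) - 1)]
  have h4 := mul_le_mul_of_nonneg_right h3 (abs_nonneg (sinFun n u))
  linarith

/-- The coercivity estimate in `L²(𝕋)`. -/
theorem coercive_L2 {u v w : L2} {C : ℝ} (hu : ∀ n, cosFun n u = 0) (hv : ∀ n, cosFun n v = 0)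
    (hw : ∀ n, cosFun n w = 0) (hu2 : sinFun 2 u = 0) (hv2 : sinFun 2 v = 0)
    (huv : ∀ p, sinFun (p + 2) v = rowFun p u) (hvw : ∀ p, sinFun (p + 2) w = rowFun p v)
    (hdec : ∀ n : ℕ, (n + 1) * |sinFun n u| ≤ C) :
    1 / 5 * ‖u‖ ^ 2 ≤ inner ℝ w u + inner ℝ v v := by
  have hz : Tendsto (fun n => sinFun n v) atTop (𝓝 0) := by
    have h1 := (parseval_sq v hv).summable.tendsto_atTop_zero
    have h2 := h1.sqrt
    simp only [Real.sqrt_sq_eq_abs, Real.sqrt_zero] at h2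
    rw [← tendsto_add_atTop_iff_nat 2]
    exact (tendsto_zero_iff_abs_tendsto_zero _).2 h2
  have hS := (parseval_inner w u hw hu).add (parseval_inner v v hv hv)
  have := coercive_hasSum (y := fun n => sinFun n u) (z := fun n => sinFun n v)
    (x := fun n => sinFun n w) huv hvw (sinFun_one u) hu2 (sinFun_one v) hv2 hdec hz
    (parseval_sq u hu) hS
  have hp := pi_pos
  rw [← mul_add] at this
  refine le_of_mul_le_mul_left ?_ hp
  linarith

/-! ### Time evolution -/

theorem hasDerivWithinAt_clm {W : ℝ → L2} {w : L2} {s : Set ℝ} {t : ℝ}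
    (hW : HasDerivWithinAt W w s t) (Φ : L2 →L[ℝ] ℝ) :
    HasDerivWithinAt (fun r => Φ (W r)) (Φ w) s t :=
  Φ.hasFDerivAt.comp_hasDerivWithinAt t hW

/-- Linear relations between curves in `L²` pass to their derivatives. -/
theorem clm_eq_of_hasDerivWithinAt {W W' : ℝ → L2} {w w' : L2} {T t : ℝ} (hT : 0 < T)
    (ht : t ∈ Icc 0 T) (hW : HasDerivWithinAt W w (Icc 0 T) t)
    (hW' : HasDerivWithinAt W' w' (Icc 0 T) t) {Φ Ψ : L2 →L[ℝ] ℝ}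
    (h : ∀ r ∈ Icc 0 T, Φ (W r) = Ψ (W' r)) : Φ w = Ψ w' := by
  have h1 := hasDerivWithinAt_clm hW Φ
  have h2 := (hasDerivWithinAt_clm hW' Ψ).congr h (h t ht)
  exact ((uniqueDiffOn_Icc hT) t ht).eq_deriv _ h1 h2

/-- Relations between continuous curves extend from the open to the closed interval. -/
theorem eqOn_Icc_of_Ioo {a b : ℝ → ℝ} {T : ℝ} (hT : 0 < T) (ha : ContinuousOn a (Icc 0 T))
    (hb : ContinuousOn b (Icc 0 T)) (h : ∀ t ∈ Ioo 0 T, a t = b t) :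
    ∀ t ∈ Icc 0 T, a t = b t :=
  Set.EqOn.of_subset_closure (s := Ioo 0 T) (t := Icc 0 T) h ha hb Ioo_subset_Icc_self
    (by rw [closure_Ioo hT.ne])

theorem HasRegularity.exists_curve {m : ℕ} {T : ℝ} {η : ℝ → ℝ → ℝ} (hT : 0 < T)
    (h : HasRegularity m T η) :
    ∃ W W1 W2 : ℝ → L2,
      (∀ t ∈ Icc 0 T, (W t : ℝ → ℝ) =ᵐ[torusMeasure] weightedDeriv (η t)) ∧
      (∀ t ∈ Icc 0 T, HasDerivWithinAt W (W1 t) (Icc 0 T) t) ∧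
      (∀ t ∈ Icc 0 T, HasDerivWithinAt W1 (W2 t) (Icc 0 T) t) := by
  obtain ⟨-, V, hV, hrep⟩ := h
  let P : Sobolev (m - 2) →L[ℝ] L2 :=
    (PiLp.proj 2 (fun _ : Fin (m - 2 + 1) => L2) 0 : _ →L[ℝ] L2).comp
      (Sobolev (m - 2)).subtypeL
  have hW : ContDiffOn ℝ 2 (fun t => P (V t)) (Icc 0 T) := P.contDiff.comp_contDiffOn hV
  have hu := uniqueDiffOn_Icc hT
  have h2 : (2 : WithTop ℕ∞) = 1 + 1 := by norm_num
  rw [h2, contDiffOn_succ_iff_derivWithin hu] at hW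
  refine ⟨fun t => P (V t), derivWithin (fun t => P (V t)) (Icc 0 T),
    derivWithin (derivWithin (fun t => P (V t)) (Icc 0 T)) (Icc 0 T), hrep, fun t ht => ?_,
    fun t ht => ?_⟩
  · exact (hW.1 t ht).hasDerivWithinAt
  · exact (hW.2.2.differentiableOn one_ne_zero t ht).hasDerivWithinAt

theorem HasRegularity.decay {m : ℕ} (hm : 0 < m) {T : ℝ} {η : ℝ → ℝ → ℝ}
    (h : HasRegularity m T η) {t : ℝ} (ht : t ∈ Icc 0 T) {u : L2}
    (hu : (u : ℝ → ℝ) =ᵐ[torusMeasure] weightedDeriv (η t)) :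
    ∃ C : ℝ, ∀ n : ℕ, (n + 1) * |sinFun n u| ≤ C := by
  obtain ⟨⟨U, -, hrep⟩, -⟩ := h
  have h1 := (U t).2 (⟨0, hm⟩ : Fin m)
  have h2 : (U t).1 0 = u := Lp.ext ((hrep t ht).trans hu.symm)
  have h3 : (⟨0, hm⟩ : Fin m).castSucc = 0 := rfl
  rw [h3, h2] at h1
  exact h1.sinFun_decay

theorem energy_growth {m : ℕ} (hm : 3 < m) {η₀p η₀m : ℝ → ℝ} {ηp ηm : ℝ → ℝ → ℝ} {T : ℝ}
    (hT : 0 < T) (hsol : IsSolutionOn m T η₀p η₀m ηp ηm) (hne : norm2 η₀p ≠ 0)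
    (hpos : 0 ≤ inner2 (Lplus η₀p) η₀p) :
    growth (1 / 25) η₀p T < norm2 (ηp T) ^ 2 ∧ 0 < growth (1 / 25) η₀p T := by
  obtain ⟨W, W1, W2, hrep, d1, d2⟩ := hsol.regularity_plus.exists_curve hT
  have hodd := hsol.oddC1_plus
  have c0 : ContinuousOn W (Icc 0 T) := fun t ht => (d1 t ht).continuousWithinAt
  have c1 : ContinuousOn W1 (Icc 0 T) := fun t ht => (d2 t ht).continuousWithinAt
  have m0 : (0 : ℝ) ∈ Icc 0 T := ⟨le_rfl, hT.le⟩
  have mT : T ∈ Icc 0 T := ⟨hT.le, le_rfl⟩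
  have cosW : ∀ n, ∀ t ∈ Icc 0 T, cosFun n (W t) = 0 := fun n t ht =>
    cosFun_eq_zero (hodd t ht).weightedDeriv_odd (hrep t ht) n
  have cosW1 : ∀ n, ∀ t ∈ Icc 0 T, cosFun n (W1 t) = 0 := fun n t ht =>
    clm_eq_of_hasDerivWithinAt (Ψ := 0) hT ht (d1 t ht) (d1 t ht) (cosW n)
  have cosW2 : ∀ n, ∀ t ∈ Icc 0 T, cosFun n (W2 t) = 0 := fun n t ht =>
    clm_eq_of_hasDerivWithinAt (Ψ := 0) hT ht (d2 t ht) (d2 t ht) (cosW1 n)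
  have sW : ∀ t ∈ Icc 0 T, sinFun 2 (W t) = 0 := fun t ht => (hodd t ht).sinFun_two (hrep t ht)
  have sW1 : ∀ t ∈ Icc 0 T, sinFun 2 (W1 t) = 0 := fun t ht =>
    clm_eq_of_hasDerivWithinAt (Ψ := 0) hT ht (d1 t ht) (d1 t ht) sW
  -- Evaluating the primitive at θ is a bounded functional, so it commutes with d/dt in L².
  -- Uniqueness of the derivative identifies the result with ∂ₜη⁺ = L⁺η⁺.
  have prim : ∀ t ∈ Ioo 0 T, EqOn (primitive (W1 t)) (Lplus (ηp t)) (Icc (-π) π) := by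
    intro t ht θ hθ
    obtain ⟨Φ, hΦ⟩ := exists_primitive_functional hθ
    have hn : Icc 0 T ∈ 𝓝 t := Icc_mem_nhds ht.1 ht.2
    have h1 := (hasDerivWithinAt_clm (d1 t (Ioo_subset_Icc_self ht)) Φ).hasDerivAt hn
    rw [← hΦ]
    refine h1.unique ((hsol.equation_plus t ht θ).congr_of_eventuallyEq ?_)
    filter_upwards [hn] with r hr
    rw [hΦ, (hodd r hr).primitive_eq (hrep r hr) hθ]
  have row1 : ∀ p, ∀ t ∈ Icc 0 T, sinFun (p + 2) (W1 t) = rowFun p (W t) := fun p =>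
    eqOn_Icc_of_Ioo hT ((sinFun (p + 2)).continuous.comp_continuousOn c1)
      ((rowFun p).continuous.comp_continuousOn c0) fun t ht =>
      (hodd t (Ioo_subset_Icc_self ht)).sinFun_eq_rowFun (hrep t (Ioo_subset_Icc_self ht))
        (sW1 t (Ioo_subset_Icc_self ht)) (prim t ht) p
  -- Differentiating the row relations in time replaces any second application of L⁺ to a function.
  have row2 : ∀ p, ∀ t ∈ Icc 0 T, sinFun (p + 2) (W2 t) = rowFun p (W1 t) := fun p t ht =>
    clm_eq_of_hasDerivWithinAt hT ht (d2 t ht) (d1 t ht) (row1 p)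
  have hodd0 : IsOddC1 η₀p := hsol.initial_plus ▸ hodd 0 m0
  have hrep0 : (W 0 : ℝ → ℝ) =ᵐ[torusMeasure] weightedDeriv η₀p := hsol.initial_plus ▸ hrep 0 m0
  have primOdd : ∀ θ ∈ Icc (-π) π, primitive (W1 0) (-θ) = -primitive (W1 0) θ := by
    intro θ hθ
    have hθ' : -θ ∈ Icc (-π) π := ⟨by linarith [hθ.2], by linarith [hθ.1]⟩
    obtain ⟨Φ, hΦ⟩ := exists_primitive_functional hθ
    obtain ⟨Ψ, hΨ⟩ := exists_primitive_functional hθ'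
    rw [← hΦ, ← hΨ]
    refine eqOn_Icc_of_Ioo hT (a := fun t => Ψ (W1 t)) (b := fun t => -Φ (W1 t))
      (Ψ.continuous.comp_continuousOn c1) (Φ.continuous.comp_continuousOn c1).neg ?_ 0 m0
    intro t ht
    rw [hΦ, hΨ, prim t ht hθ, prim t ht hθ', (hodd t (Ioo_subset_Icc_self ht)).Lplus_odd]
  -- At t = 0 the relations between coefficients survive by continuity; two continuous odd functions
  -- with equal sine coefficients coincide.
  have prim0 : EqOn (primitive (W1 0)) (Lplus η₀p) (Ioo (-π) π) := by
    have hcL := hodd0.continuous_Lplus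
    have h := eqOn_zero_of_sineCoeff (g := fun θ => primitive (W1 0) θ - Lplus η₀p θ)
      ((primitive_continuousOn _).sub hcL.continuousOn)
      (fun θ hθ => by rw [primOdd θ hθ, hodd0.Lplus_odd]; ring) (fun k => by
        have e := hodd0.sineCoeff_primitive_eq hrep0 (sW1 0 m0) (fun p => row1 p 0 m0) k
        rw [← sub_eq_zero] at e
        refine Eq.trans ?_ e
        rw [sineCoeff, sineCoeff, sineCoeff, ← intervalIntegral.integral_sub]
        · simp only [sub_mul]
        · refine ContinuousOn.intervalIntegrable ?_
          rw [uIcc_pi]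
          exact (primitive_continuousOn _).mul (by fun_prop)
        · exact (by fun_prop : Continuous _).intervalIntegrable _ _)
    intro θ hθ
    have := h hθ
    simp only [Pi.zero_apply] at this
    linarith
  have derivL : ∀ᵐ θ ∂torusMeasure, W1 0 θ * (2 * √π * sin θ) = deriv (Lplus η₀p) θ := by
    have h1 : ∀ᵐ θ : ℝ, θ ≠ π := by simp [ae_iff, measure_singleton]
    filter_upwards [ae_restrict_of_ae (primitive_ae_hasDerivAt (W1 0)), ae_restrict_of_ae h1,
      ae_restrict_mem measurableSet_Ioc] with θ h2 h3 h4
    have h5 : θ ∈ Ioo (-π) π := ⟨h4.1, lt_of_le_of_ne h4.2 h3⟩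
    have h6 := h2 (by rw [uIcc_pi]; exact Ioc_subset_Icc_self h4)
    refine (h6.congr_of_eventuallyEq ?_).deriv.symm
    filter_upwards [isOpen_Ioo.mem_nhds h5] with x hx
    exact (prim0 hx).symm
  have e0 : inner2 η₀p η₀p = ‖W 0‖ ^ 2 := by
    rw [inner2_eq (ae_deriv_eq hrep0) (ae_deriv_eq hrep0), real_inner_self_eq_norm_sq]
  have e1 : inner2 (Lplus η₀p) η₀p = inner ℝ (W 0) (W1 0) := by
    rw [inner2_eq derivL (ae_deriv_eq hrep0), real_inner_comm]
  have en : norm2 η₀p = ‖W 0‖ := norm2_eq hrep0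
  have eT : norm2 (ηp T) = ‖W T‖ := norm2_eq (hrep T mT)
  have hE0 : 0 < ‖W 0‖ ^ 2 := by rw [en] at hne; positivity
  have hg : growth (1 / 25) η₀p T = hyperbolic (1 / 25) (‖W 0‖ ^ 2) (inner ℝ (W 0) (W1 0)) T := by
    rw [← e0, ← e1]; rfl
  rw [e1] at hpos
  rw [hg, eT]
  refine ⟨?_, hyperbolic_pos hE0 hpos hT.le⟩
  -- `coercive_L2` gives E'' ≥ 2·(1/5)·E = 4·(1/10)·E.
  refine hyperbolic_lt (mu := 1 / 10) (E := fun t => ‖W t‖ ^ 2)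
    (E1 := fun t => 2 * inner ℝ (W t) (W1 t))
    (E2 := fun t => 2 * (inner ℝ (W t) (W2 t) + inner ℝ (W1 t) (W1 t)))
    (by norm_num) (by norm_num) hT (c0.norm.pow 2) ((c0.inner c1).const_smul (2 : ℝ)) ?_ ?_
    (fun t _ => by positivity) ?_ hE0 (by linarith) rfl
  · exact fun t ht => (d1 t (Ioo_subset_Icc_self ht)).norm_sq.hasDerivAt (Icc_mem_nhds ht.1 ht.2)
  · exact fun t ht => (((d1 t (Ioo_subset_Icc_self ht)).inner ℝ
      (d2 t (Ioo_subset_Icc_self ht))).const_mul 2).hasDerivAt (Icc_mem_nhds ht.1 ht.2)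
  · intro t ht
    have ht' := Ioo_subset_Icc_self ht
    obtain ⟨C, hC⟩ := hsol.regularity_plus.decay (by omega) ht' (hrep t ht')
    have := coercive_L2 (fun n => cosW n t ht') (fun n => cosW1 n t ht') (fun n => cosW2 n t ht')
      (sW t ht') (sW1 t ht') (fun p => row1 p t ht') (fun p => row2 p t ht') hC
    rw [real_inner_comm] at this
    linarith

end MHD

end

theorem mainTheorem3 :
    ∃ lam : ℝ, 1 / 50 < lam ∧ lam < 3 / 5 ∧
      ∀ (m : ℕ), 3 < m →
      ∀ (η₀p η₀m : ℝ → ℝ), MHD.IsInitialDatum m η₀p → MHD.IsInitialDatum m η₀m →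
        MHD.norm2 η₀p ≠ 0 →
        0 ≤ MHD.inner2 (MHD.Lplus η₀p) η₀p →
      ∀ (ηp ηm : ℝ → ℝ → ℝ),
        (∀ T : ℝ, 0 < T → MHD.IsSolutionOn m T η₀p η₀m ηp ηm) →
      ∀ t : ℝ, 0 < t →
        √(MHD.growth lam η₀p t) < MHD.norm2 (ηp t) + MHD.norm2 (ηm t) ∧
          0 < √(MHD.growth lam η₀p t) := by
  -- The comparison argument requires a value below the coercivity constant 1/10; 1/25 also exceeds
  -- 1/50.
  refine ⟨1 / 25, by norm_num, by norm_num, ?_⟩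
  intro m hm η₀p η₀m _ _ hne hpos ηp ηm hsol t ht
  obtain ⟨h1, h2⟩ := MHD.energy_growth hm ht (hsol t ht) hne hpos
  refine ⟨?_, Real.sqrt_pos.2 h2⟩
  have h3 : √(MHD.growth (1 / 25) η₀p t) < MHD.norm2 (ηp t) :=
    (Real.sqrt_lt' ((Real.sqrt_nonneg _).lt_of_ne fun h0 => by
      have : MHD.norm2 (ηp t) = 0 := h0.symm
      rw [this] at h1
      norm_num at h1
      linarith)).2 h1
  have h4 : 0 ≤ MHD.norm2 (ηm t) := Real.sqrt_nonneg _
  linarith
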